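/- Let $z_1,z_2,z_3\in\mathbb C$ be distinct, let $\Sigma$ be the projective nodal curve obtained from $\mathbb CP^1$ by gluing $z_1$ and $z_2$, and let $p\in\Sigma$ be the point $z=z_3$. For $\Lambda,U\in GL_n(\mathbb C)$ let $V=V_\Lambda$ be the rank $n$ bundle on $\Sigma$ whose sections over $\Sigma\setminus\infty$ are the $s\in\mathbb C[z]^n$ with $s(z_1)=\Lambda s(z_2)$ and which is trivial away from the node, with the trivialization $U$ of its fibre at $p$. Let $\mathcal M$ be the principal cell of the moduli space of such framed bundles, where $\Lambda$ has distinct eigenvalues. (1) The map $(\Lambda,U)\mapsto U^{-1}\Lambda U$ is a submersion. It identifies $\mathcal M$, the set of isomorphism classes of framed bundles, with the open set of invertible matrices with distinct eigenvalues. The global sections of $End(V)^*\otimes\mathcal K\otimes\mathcal O(p)$ are, with $End(V)^*\cong End(V)$ by the trace form, the $\Phi(z)\,dz$ with $$\Phi(z)=\frac{\Phi_1}{z-z_1}-\frac{\Phi_2}{z-z_2}+\frac{\Phi_3}{z-z_3},\qquad \Phi_1\Lambda=\Lambda\Phi_2,\quad \Phi_1-\Phi_2+\Phi_3=0 .$$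 (2) On the space of quadruples $(\Lambda,U,\Phi_1,\Phi_3)$ with $\Lambda,U$ invertible consider $$\lambda'=\mathrm{Tr}(\Lambda^{-1}\Phi_1\,d\Lambda)+\mathrm{Tr}(U^{-1}\Phi_3\,dU),\qquad \omega'=\mathrm{Tr}\,d(\Lambda^{-1}\Phi_1)\wedge d\Lambda+\mathrm{Tr}\,d(U^{-1}\Phi_3)\wedge dU .$$ The action $(g\Lambda g^{-1},gU,g\Phi_1g^{-1},g\Phi_3g^{-1})$ of $GL_n$ preserves $\omega'$ and is Hamiltonian with moment map $\mu=\Phi_1-\Phi_2+\Phi_3$, where $\Phi_2=\Lambda^{-1}\Phi_1\Lambda$: the generating field $\xi_a$ of $a\in gl_n$ satisfies $\lambda'(\xi_a)=\mathrm{Tr}(\mu a)$ and $\omega'(\xi_a,\cdot)=-d\,\mathrm{Tr}(\mu a)$. Over the principal cell, $(\Lambda,U,\Phi_1,\Phi_3)\mapsto (V,U,\Phi(z)dz)$ defines a surjective submersion $P:\mu^{-1}(0)\to\mathcal T^*\mathcal M$ whose fibres are the $GL_n$-orbits. Here $\mathcal T_V\mathcal M\cong H^1(\Sigma,End(V)\otimes\mathcal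 O(-p))$, a matrix polynomial $\chi$ representing the deformation $\delta\Lambda=\chi(z_1)\Lambda-\Lambda\chi(z_2)$, $\delta U=\chi(z_3)U$, and $\Phi$ is a covector by Serre's pairing $\langle\Phi,\chi\rangle=\sum_{i=1}^3\mathrm{Res}_{z_i}\mathrm{Tr}(\Phi\chi)\,dz$. The canonical one-form and the canonical symplectic form ($\omega=d\lambda$) of $\mathcal T^*\mathcal M$ pull back under $P$ to the restrictions of $\lambda'$ and $\omega'$ to $\mu^{-1}(0)$. (3) The action $U\mapsto Uh$ of $GL_n$ preserves $\omega'$ and is Hamiltonian with moment map $J=U^{-1}\Phi_3U$, with the same sign conventions. For $\nu\in gl_n(\mathbb C)$, every point of $\mu^{-1}(0)\cap J^{-1}(\nu)$ over the principal cell is conjugate to a point with $\Lambda=\mathrm{diag}(e^{2x_i})$, $e^{2x_i}$ distinct, $(\Phi_1)_{ii}=p_i$, $\Phi_3=f=U\nu U^{-1}$, $f_{ii}=0$, $(\Phi_1)_{ij}=f_{ij}/(e^{2x_j-2x_i}-1)$ for $i\ne j$; conversely these points lie in $\mu^{-1}(0)\cap J^{-1}(\nu)$. Two of them are equivalent under $GL_n$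 and the stabilizer of $\nu$ (acting on $U$) if and only if their $(e^{2x_i}),(p_i),(f_{ij})$ agree up to a simultaneous permutation of the indices and conjugation of $f$ by a diagonal matrix. In the coordinates $(x,p,U)$ the form $\omega'$ becomes $2\sum_i dp_i\wedge dx_i$ plus the Kirillov–Kostant form of the orbit of $f$, given on the tangent vectors $[a,f]$, $[b,f]$ with $a=\delta U\,U^{-1}$, $b=\delta'U\,U^{-1}$ by $-\mathrm{Tr}(f[a,b])$. (4) At every point of $\mu^{-1}(0)$ over the principal cell with $\Lambda=\mathrm{diag}(e^{2x_i})$, and with $p_i=(\Phi_1)_{ii}$, $f_{ij}=(\Phi_3)_{ij}$, $$H_1=\mathrm{Tr}\,\Phi_1^2=\sum_{i=1}^np_i^2-\frac14\sum_{i\ne j}\frac{f_{ij}f_{ji}}{\sinh^2(x_i-x_j)},\qquad H_2=\mathrm{Tr}\,\Phi_1\Phi_2=\sum_{i=1}^np_i^2-\sum_{i\neq j}\frac{f_{ij}f_{ji}}{(e^{2x_j-2x_i}-1)^2},$$ so $H_1$ is the Hamiltonian of the trigonometric Calogero–Moser system with spin. -/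

import Mathlib

open Polynomial Matrix
open scoped Polynomial Matrix

noncomputable section

namespace NodeHitchin

/-! ## The nodal curve with a marked point, framed bundles -/

/-- The projective nodal curve obtained from the Riemann sphere by gluing `z₁` and `z₂`, together
with a marked smooth point `p` at `z = z₃`. -/
structure MarkedNode where
  z₁ : ℂ
  z₂ : ℂ
  z₃ : ℂ
  ne₁₂ : z₁ ≠ z₂
  ne₁₃ : z₁ ≠ z₃
  ne₂₃ : z₂ ≠ z₃

/-- `n × n` complex matrices. -/
abbrev Mat (n : ℕ) := Matrix (Fin n) (Fin n) ℂ

/-- Matrices of polynomials in the coordinate `z`. -/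
abbrev PolyMat (n : ℕ) := Matrix (Fin n) (Fin n) ℂ[X]

/-- Matrices of rational functions in the coordinate `z`. -/
abbrev RatMat (n : ℕ) := Matrix (Fin n) (Fin n) (RatFunc ℂ)

variable {n : ℕ}

/-- The value at `a` of a polynomial matrix. -/
def evalMat (a : ℂ) (χ : PolyMat n) : Mat n := χ.map (Polynomial.eval a)

/-- The module `M_Λ` of sections over the affine part of the node (the complement of `∞`):
vector polynomials with `s(z₁) = Λ s(z₂)`.  The vector bundle `V = V_Λ` on the projective node is
given by `M_Λ` on the affine part, and is the trivial bundle away from the singular point. -/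
def bundleModule (N : MarkedNode) (Λ : Mat n) : Set (Fin n → ℂ[X]) :=
  {s | (fun i => (s i).eval N.z₁) = Λ *ᵥ (fun i => (s i).eval N.z₂)}

/-- Isomorphism of the framed bundles `(V_Λ, U)` and `(V_Λ', U')` on the projective node: a matrix
function that is regular and invertible on the normalization, both at finite points and at
infinity, that carries `M_Λ` onto `M_Λ'`, and that carries the trivialization `U` of the fibre at
the marked point to `U'`. -/
def FramedIso (N : MarkedNode) (m m' : Mat n × Mat n) : Prop :=
  ∃ K : (PolyMat n)ˣ,
    (∀ i j, ((K : PolyMat n) i j).natDegree = 0) ∧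
    (∀ i j, (((K⁻¹ : (PolyMat n)ˣ) : PolyMat n) i j).natDegree = 0) ∧
    (∀ s, s ∈ bundleModule N m.1 ↔ (K : PolyMat n) *ᵥ s ∈ bundleModule N m'.1) ∧
    evalMat N.z₃ (K : PolyMat n) * m.2 = m'.2

/-- Matrices that are invertible and have pairwise distinct eigenvalues. -/
def principalCell (n : ℕ) : Set (Mat n) := {Λ | IsUnit Λ.det ∧ Λ.charpoly.roots.Nodup}

/-- The bundle data `(Λ, U)` with `Λ` in the principal cell and `U` invertible. -/
def bundleData (n : ℕ) : Set (Mat n × Mat n) := {m | m.1 ∈ principalCell n ∧ IsUnit m.2.det}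

/-- The map from bundle data to the moduli space of framed bundles.  It is a complete invariant,
and it presents (the principal cell of) the moduli space as an open set of matrices. -/
def moduliMap (m : Mat n × Mat n) : Mat n := m.2⁻¹ * m.1 * m.2

/-! ## Sheaf cohomology on the node -/

/-- Residue at `a` of the differential `f dz`: the coefficient of `(z - a)⁻¹` in the Laurent
expansion of `f` at `a`. -/
def residueAt (a : ℂ) (f : RatFunc ℂ) : ℂ :=
  ((RatFunc.laurent a f : RatFunc ℂ) : LaurentSeries ℂ).coeff (-1)

/-- A polynomial matrix viewed as a matrix of rational functions. -/
def toRat (χ : PolyMat n) : RatMat n := χ.map (algebraMap ℂ[X] (RatFunc ℂ))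

/-- Endomorphisms of `M_Λ`: polynomial matrices that preserve `M_Λ`. -/
def endModule (N : MarkedNode) (Λ : Mat n) : Set (PolyMat n) :=
  {A | ∀ s ∈ bundleModule N Λ, A *ᵥ s ∈ bundleModule N Λ}

/-- The rational function `f` has no pole in `ℂ` outside `z₁, z₂, z₃`. -/
def RegularOff (N : MarkedNode) (f : RatFunc ℂ) : Prop :=
  ∀ a : ℂ, a ≠ N.z₁ → a ≠ N.z₂ → a ≠ N.z₃ → f.denom.eval a ≠ 0

/-- The rational function `f` is regular at infinity. -/
def RegularAtInfinity (f : RatFunc ℂ) : Prop := f = 0 ∨ f.intDegree ≤ 0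

theorem RegularOff.of_polynomial (N : MarkedNode) (p : ℂ[X]) :
    RegularOff N (algebraMap ℂ[X] (RatFunc ℂ) p) := by
  intro a _ _ _
  rw [RatFunc.denom_algebraMap]
  simp

theorem RegularOff.of_dvd {N : MarkedNode} {f g h : RatFunc ℂ}
    (hd : h.denom ∣ f.denom * g.denom) (hf : RegularOff N f) (hg : RegularOff N g) :
    RegularOff N h := by
  intro a h1 h2 h3 h0
  obtain ⟨q, hq⟩ := hd
  have : (f.denom * g.denom).eval a = 0 := by rw [hq, Polynomial.eval_mul, h0, zero_mul]
  rw [Polynomial.eval_mul] at this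
  exact mul_ne_zero (hf a h1 h2 h3) (hg a h1 h2 h3) this

theorem RegularOff.add {N : MarkedNode} {f g : RatFunc ℂ}
    (hf : RegularOff N f) (hg : RegularOff N g) : RegularOff N (f + g) :=
  .of_dvd (RatFunc.denom_add_dvd f g) hf hg

theorem RegularOff.smul {N : MarkedNode} {f : RatFunc ℂ} (c : ℂ)
    (hf : RegularOff N f) : RegularOff N (c • f) := by
  rw [RatFunc.smul_eq_C_mul, ← RatFunc.algebraMap_C]
  exact .of_dvd (RatFunc.denom_mul_dvd _ f) (.of_polynomial N _) hf

theorem RegularAtInfinity.add {f g : RatFunc ℂ}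
    (hf : RegularAtInfinity f) (hg : RegularAtInfinity g) : RegularAtInfinity (f + g) := by
  by_cases h : f + g = 0
  · exact .inl h
  rcases eq_or_ne g 0 with rfl | hg0
  · simpa using hf
  rcases hf with rfl | hf
  · simpa using hg
  rcases hg with rfl | hg
  · exact absurd rfl hg0
  exact .inr ((RatFunc.intDegree_add_le hg0 h).trans (max_le hf hg))

theorem RegularAtInfinity.smul {f : RatFunc ℂ} (c : ℂ)
    (hf : RegularAtInfinity f) : RegularAtInfinity (c • f) := by
  rcases eq_or_ne c 0 with rfl | hc
  · exact .inl (zero_smul _ _)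
  rcases eq_or_ne f 0 with rfl | h0
  · exact .inl (smul_zero _)
  rcases hf with rfl | hf
  · exact .inl (smul_zero _)
  right
  rw [RatFunc.smul_eq_C_mul, RatFunc.intDegree_mul (by simpa using hc) h0, RatFunc.intDegree_C]
  simpa using hf

/-- Sections of `End(V) ⊗ 𝒪(-p)` over the intersection of the two charts: the complement of `∞`
and the complement of the singular point and of `p`. -/
def cochains (N : MarkedNode) (n : ℕ) : Submodule ℂ (RatMat n) where
  carrier := {f | ∀ i j, RegularOff N (f i j)}
  add_mem' hf hg i j := (hf i j).add (hg i j)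
  zero_mem' i j := by simpa using RegularOff.of_polynomial N 0
  smul_mem' c _ hf i j := (hf i j).smul c

/-- Sections of `End(V) ⊗ 𝒪(-p)` over the complement of `∞`: endomorphisms of `M_Λ` that vanish
at `p`. -/
def affineSections (N : MarkedNode) (Λ : Mat n) : Submodule ℂ (RatMat n) :=
  Submodule.span ℂ (toRat '' {A | A ∈ endModule N Λ ∧ evalMat N.z₃ A = 0})

/-- Sections of `End(V) ⊗ 𝒪(-p)` over the complement of the singular point and of `p`. -/
def outerSections (N : MarkedNode) (n : ℕ) : Submodule ℂ (RatMat n) where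
  carrier := {f | ∀ i j, RegularOff N (f i j) ∧ RegularAtInfinity (f i j)}
  add_mem' hf hg i j := ⟨(hf i j).1.add (hg i j).1, (hf i j).2.add (hg i j).2⟩
  zero_mem' i j := ⟨by simpa using RegularOff.of_polynomial N 0, .inl rfl⟩
  smul_mem' c _ hf i j := ⟨(hf i j).1.smul c, (hf i j).2.smul c⟩

/-- The Čech cohomology group `H¹(Σ, End(V) ⊗ 𝒪(-p))` for the affine covering above. -/
abbrev H1 (N : MarkedNode) (Λ : Mat n) :=
  cochains N n ⧸ (affineSections N Λ ⊔ outerSections N n).comap (cochains N n).subtype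

/-- A polynomial matrix as a Čech cochain. -/
def polyCochain (N : MarkedNode) (χ : PolyMat n) : cochains N n :=
  ⟨toRat χ, fun i j => RegularOff.of_polynomial N (χ i j)⟩

/-- The infinitesimal deformation of `(Λ, U)` defined by `χ`, the derivative of
`Λ ↦ (1 + ε χ(z₁)) Λ (1 - ε χ(z₂))`, `U ↦ (1 + ε χ(z₃)) U`. -/
def deformation (N : MarkedNode) (m : Mat n × Mat n) (χ : PolyMat n) : Mat n × Mat n :=
  (evalMat N.z₁ χ * m.1 - m.1 * evalMat N.z₂ χ, evalMat N.z₃ χ * m.2)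

/-- Sections `w dz` over the complement of `∞` of `𝒦 ⊗ 𝒪(p)`, with `𝒦` the dualizing sheaf of the
node: at most simple poles at `z₁, z₂, z₃`, no other pole in `ℂ`, and opposite residues at the two
preimages of the node. -/
def dualizingSections (N : MarkedNode) : Set (RatFunc ℂ) :=
  {w | (∃ q : ℂ[X], w * algebraMap ℂ[X] (RatFunc ℂ)
          ((X - C N.z₁) * (X - C N.z₂) * (X - C N.z₃)) = algebraMap ℂ[X] (RatFunc ℂ) q) ∧
      residueAt N.z₁ w + residueAt N.z₂ w = 0}

/-- Global sections `Φ dz` of `End(V)* ⊗ 𝒦 ⊗ 𝒪(p)`, where `End(V)*` is identified with `End(V)` by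
the trace form: sums of products of sections of the two factors over the complement of `∞` that
are regular at `∞` as differentials. -/
def higgsFields (N : MarkedNode) (Λ : Mat n) : Set (RatMat n) :=
  {Φ | Φ ∈ Submodule.span ℂ {B : RatMat n | ∃ A ∈ endModule N Λ, ∃ w ∈ dualizingSections N,
          B = w • toRat A} ∧
      ∀ i j, Φ i j = 0 ∨ (Φ i j).intDegree ≤ -2}

/-- Serre's pairing of `Φ dz` with the class of the cochain `c`: the sum of the residues of
`Tr (Φ c) dz` at `z₁, z₂, z₃`. -/
def serrePairing (N : MarkedNode) (Φ c : RatMat n) : ℂ :=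
  residueAt N.z₁ (Φ * c).trace + residueAt N.z₂ (Φ * c).trace + residueAt N.z₃ (Φ * c).trace

/-- The matrix function `Φ₁ / (z - z₁) - Φ₂ / (z - z₂) + Φ₃ / (z - z₃)`. -/
def higgsField (N : MarkedNode) (Φ₁ Φ₂ Φ₃ : Mat n) : RatMat n :=
  (RatFunc.X - RatFunc.C N.z₁)⁻¹ • Φ₁.map RatFunc.C
    - (RatFunc.X - RatFunc.C N.z₂)⁻¹ • Φ₂.map RatFunc.C
    + (RatFunc.X - RatFunc.C N.z₃)⁻¹ • Φ₃.map RatFunc.C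

/-! ## The unreduced phase space -/

/-- The space of quadruples `(Λ, U, Φ₁, Φ₃)`. -/
abbrev Quad (n : ℕ) := Mat n × Mat n × Mat n × Mat n

namespace Quad

/-- The component `Λ`. -/
abbrev L (y : Quad n) : Mat n := y.1

/-- The component `U`. -/
abbrev U (y : Quad n) : Mat n := y.2.1

/-- The component `Φ₁`. -/
abbrev Φ₁ (y : Quad n) : Mat n := y.2.2.1

/-- The component `Φ₃`. -/
abbrev Φ₃ (y : Quad n) : Mat n := y.2.2.2

/-- The matrix `Φ₂`, determined by `Φ₁ Λ = Λ Φ₂`. -/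
def Φ₂ (y : Quad n) : Mat n := y.L⁻¹ * y.Φ₁ * y.L

end Quad

/-- The quadruples with `Λ` and `U` invertible: the cotangent bundle of `GL_n × GL_n`. -/
def phaseSpace (n : ℕ) : Set (Quad n) := {y | IsUnit y.L.det ∧ IsUnit y.U.det}

/-- The one-form `Tr (Λ⁻¹ Φ₁ dΛ) + Tr (U⁻¹ Φ₃ dU)`. -/
def oneForm (y v : Quad n) : ℂ :=
  (y.L⁻¹ * y.Φ₁ * v.L).trace + (y.U⁻¹ * y.Φ₃ * v.U).trace

/-- The two-form `Tr (dA ∧ dB)` for matrix-valued functions `A`, `B`. -/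
def traceWedge (A B : Quad n → Mat n) (y v w : Quad n) : ℂ :=
  (fderiv ℂ A y v * fderiv ℂ B y w).trace - (fderiv ℂ A y w * fderiv ℂ B y v).trace

/-- The two-form `Tr (d(Λ⁻¹ Φ₁) ∧ dΛ) + Tr (d(U⁻¹ Φ₃) ∧ dU)`. -/
def nodeForm (y v w : Quad n) : ℂ :=
  traceWedge (fun y => y.L⁻¹ * y.Φ₁) (fun y => y.L) y v w
    + traceWedge (fun y => y.U⁻¹ * y.Φ₃) (fun y => y.U) y v w

/-- The action of `GL_n` by conjugation (change of basis of the bundle). -/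
def conjAct (g : GL (Fin n) ℂ) (y : Quad n) : Quad n :=
  ((g : Mat n) * y.L * (g⁻¹ : GL (Fin n) ℂ), (g : Mat n) * y.U,
    (g : Mat n) * y.Φ₁ * (g⁻¹ : GL (Fin n) ℂ), (g : Mat n) * y.Φ₃ * (g⁻¹ : GL (Fin n) ℂ))

/-- The infinitesimal conjugation action of `a ∈ gl_n`. -/
def conjField (a : Mat n) (y : Quad n) : Quad n :=
  (a * y.L - y.L * a, a * y.U, a * y.Φ₁ - y.Φ₁ * a, a * y.Φ₃ - y.Φ₃ * a)

/-- The function `Φ₁ - Φ₂ + Φ₃`. -/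
def conjMoment (y : Quad n) : Mat n := y.Φ₁ - y.Φ₂ + y.Φ₃

/-- The level set `Φ₁ - Φ₂ + Φ₃ = 0` over the principal cell. -/
def zeroLevel (n : ℕ) : Set (Quad n) := {y | (y.L, y.U) ∈ bundleData n ∧ conjMoment y = 0}

/-- The action `U ↦ U h` of `GL_n` (change of the trivialization at the marked point). -/
def frameAct (h : GL (Fin n) ℂ) (y : Quad n) : Quad n := (y.L, y.U * (h : Mat n), y.Φ₁, y.Φ₃)

/-- The infinitesimal action of `a ∈ gl_n` on the framing. -/
def frameField (a : Mat n) (y : Quad n) : Quad n := (0, y.U * a, 0, 0)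

/-- The function `U⁻¹ Φ₃ U`. -/
def frameMoment (y : Quad n) : Mat n := y.U⁻¹ * y.Φ₃ * y.U

/-! ## The cotangent bundle of the moduli space -/

/-- The exterior derivative of a one-form `λ` on an open subset of a topological vector space:
`dλ(v, w) = D_v (λ(w)) - D_w (λ(v))` for constant vector fields `v`, `w`. -/
def extd {E : Type*} [AddCommGroup E] [Module ℂ E] [TopologicalSpace E] (l : E → E → ℂ)
    (y v w : E) : ℂ :=
  fderiv ℂ (fun y => l y w) y v - fderiv ℂ (fun y => l y v) y w

/-- The cotangent bundle of (an open subset of) the space of matrices: a pair `(X, A)` is the point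
`X` with the covector `B ↦ Tr (A B)`. -/
abbrev Cotangent (n : ℕ) := Mat n × Mat n

/-- The canonical one-form `λ_{(X,A)}(ξ) = Tr (A π_* ξ)`. -/
def canonicalOneForm (q ξ : Cotangent n) : ℂ := (q.2 * ξ.1).trace

/-- The canonical symplectic form `ω = dλ`. -/
def canonicalForm (q ξ η : Cotangent n) : ℂ := extd canonicalOneForm q ξ η

/-! ## Calogero–Moser coordinates -/

/-- Coordinates: positions `x`, momenta `p` and the framing `U`. -/
abbrev CMCoord (n : ℕ) := (Fin n → ℂ) × (Fin n → ℂ) × Mat n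

/-- The spin matrix `f = U ν U⁻¹` for a fixed value `ν` of the moment map of the framing. -/
def spin (ν : Mat n) (c : CMCoord n) : Mat n := c.2.2 * ν * c.2.2⁻¹

/-- The point with `Λ = diag(e^{2 x_i})`, `(Φ₁)_{ii} = p_i`, `Φ₃ = f = U ν U⁻¹`, and
`(Φ₁)_{ij} = f_{ij} / (e^{2 x_j - 2 x_i} - 1)` for `i ≠ j`. -/
def cmPoint (ν : Mat n) (c : CMCoord n) : Quad n :=
  (Matrix.diagonal fun i => Complex.exp (2 * c.1 i), c.2.2,
    Matrix.of fun i j => if i = j then c.2.1 i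
      else spin ν c i j / (Complex.exp (2 * c.1 j - 2 * c.1 i) - 1),
    spin ν c)

/-- The admissible coordinates: distinct eigenvalues `e^{2 x_i}`, invertible framing. -/
def cmDomain (n : ℕ) : Set (CMCoord n) :=
  {c | (Function.Injective fun i => Complex.exp (2 * c.1 i)) ∧ IsUnit c.2.2.det}

/-- The admissible coordinates subject to the constraint `f_{ii} = 0`. -/
def cmLevel (ν : Mat n) : Set (CMCoord n) := {c | c ∈ cmDomain n ∧ ∀ i, spin ν c i i = 0}

/-- The form `2 ∑ dp_i ∧ dx_i` plus the Kirillov–Kostant form of the orbit of `f`, whose value on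
the tangent vectors `[a, f]`, `[b, f]` is `-Tr (f [a, b])`, where `a = δU U⁻¹`, `b = δ'U U⁻¹`. -/
def cmForm (ν : Mat n) (c v w : CMCoord n) : ℂ :=
  2 * ∑ i, (v.2.1 i * w.1 i - w.2.1 i * v.1 i)
    - (spin ν c * (v.2.2 * c.2.2⁻¹ * (w.2.2 * c.2.2⁻¹)
        - w.2.2 * c.2.2⁻¹ * (v.2.2 * c.2.2⁻¹))).trace

end NodeHitchin

end

open NodeHitchin

noncomputable section

namespace NodeHitchin

/-! Everything reduces to the conjugation-invariant matrices `X = U⁻¹ Λ U` and `A = U⁻¹ (Λ⁻¹ Φ₁) U`,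
the components of `reductionMap`. An isomorphism of framed bundles is constant in `z`, and the
framings force it to be `U' U⁻¹`. Hence `X` is a complete invariant (`framedIso_iff`). On the zero
level `Φ₃ = [Λ⁻¹ Φ₁, Λ]`, so `(X, A)` determines the quadruple up to `g = U' U⁻¹`
(`reductionMap_eq_iff`). With `u = δU U⁻¹`, `δX = U⁻¹ (δΛ + [Λ, u]) U`, so `Tr (A δX) = Tr (Λ⁻¹ Φ₁
δΛ) + Tr ([Λ⁻¹ Φ₁, Λ] u)`, which is `λ'` on the zero level (`canonicalOneForm_reductionMap`). The
statement on two-forms follows from the linearised constraint and cyclicity of the trace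
(`canonicalForm_reductionMap`). For cohomology, evaluation of a polynomial at a special point `a` is
extended to rational functions as the sum of the residues of `f dz / (z - a)` (`evalRes`). If `f` is
regular at infinity, the residue theorem makes this number the same for all three points
(`evalRes_eq_evalRes`). The deformation formula thus extends to all Čech cochains, and its kernel is
exactly the coboundaries (`ker_kodairaSpencer`). The same functionals compute Serre's pairing, which
becomes the trace pairing with `A` (`trace_mul_kodairaSpencer`). Higgs fields are found by splitting
off principal parts: decay of order `z⁻²` at infinity removes the polynomial part and makes the
residues sum to zero (`eq_zero_of_mem_degLE`, `mem_higgsFields_iff`). For Calogero–Moser, `Λ` is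
diagonalised. The constraint then reads `(1 - e^{2x_j - 2x_i}) (Φ₁)_{ij} + f_{ij} = 0` entrywise
(`conjMoment_eq_zero_iff`), and the remaining gauge freedom consists of monomial matrices
(`exists_eq_monomialMatrix`). Since `δΛ` is diagonal, only the diagonal of `Φ₁` contributes to the
form (`nodeForm_cmPoint`). -/

/-! ## Differentials of matrix-valued functions -/

section Calculus

-- An auxiliary norm, needed for the product and inverse rules. The derivative depends only on the
-- topology, so the results can be restated without it.
attribute [local instance] Matrix.linftyOpNormedRing Matrix.linftyOpNormedAlgebra

variable {n : ℕ} {E : Type*} [NormedAddCommGroup E] [NormedSpace ℂ E]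

/-- The matrix-valued function `f` is differentiable at `x` with differential `D`. -/
def HasDifferential (f : E → Mat n) (x : E) (D : E → Mat n) : Prop :=
  DifferentiableAt ℂ f x ∧ ∀ v, fderiv ℂ f x v = D v

namespace HasDifferential

variable {f g : E → Mat n} {x : E} {D D' : E → Mat n}

theorem of_hasFDerivAt {f' : E →L[ℂ] Mat n} (h : HasFDerivAt f f' x) :
    HasDifferential f x f' :=
  ⟨h.differentiableAt, fun v => by rw [h.fderiv]⟩

theorem congr_right (h : HasDifferential f x D) (hD : ∀ v, D v = D' v) :
    HasDifferential f x D' :=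
  ⟨h.1, fun v => (h.2 v).trans (hD v)⟩

theorem const (A : Mat n) : HasDifferential (fun _ : E => A) x (fun _ => 0) :=
  (of_hasFDerivAt (hasFDerivAt_const A x)).congr_right fun _ => rfl

theorem add (hf : HasDifferential f x D) (hg : HasDifferential g x D') :
    HasDifferential (fun y => f y + g y) x (fun v => D v + D' v) :=
  (of_hasFDerivAt (hf.1.hasFDerivAt.add hg.1.hasFDerivAt)).congr_right fun v => by
    rw [← hf.2, ← hg.2]; rfl

theorem sub (hf : HasDifferential f x D) (hg : HasDifferential g x D') :
    HasDifferential (fun y => f y - g y) x (fun v => D v - D' v) :=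
  (of_hasFDerivAt (hf.1.hasFDerivAt.sub hg.1.hasFDerivAt)).congr_right fun v => by
    rw [← hf.2, ← hg.2]; rfl

theorem mul (hf : HasDifferential f x D) (hg : HasDifferential g x D') :
    HasDifferential (fun y => f y * g y) x (fun v => D v * g x + f x * D' v) :=
  (of_hasFDerivAt (hf.1.hasFDerivAt.mul' hg.1.hasFDerivAt)).congr_right fun v => by
    rw [← hf.2, ← hg.2, add_comm]; rfl

theorem inv (hf : HasDifferential f x D) (hx : IsUnit (f x).det) :
    HasDifferential (fun y => (f y)⁻¹) x (fun v => -((f x)⁻¹ * D v * (f x)⁻¹)) := by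
  obtain ⟨u, hu⟩ := (Matrix.isUnit_iff_isUnit_det _).2 hx
  have hi : ((u⁻¹ : (Mat n)ˣ) : Mat n) = (f x)⁻¹ := by
    rw [← hu, Matrix.coe_units_inv]
  have h := hasFDerivAt_ringInverse (𝕜 := ℂ) u
  rw [hu] at h
  have h2 := h.comp x hf.1.hasFDerivAt
  have he : (Ring.inverse ∘ f) = fun y => (f y)⁻¹ := by
    funext y; simp [Matrix.nonsing_inv_eq_ringInverse]
  rw [he] at h2
  refine (of_hasFDerivAt h2).congr_right fun v => ?_
  rw [← hf.2, ← hi]; rfl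

theorem of_clm (T : E →L[ℂ] Mat n) (h : ∀ v, f v = T v) : HasDifferential f x f := by
  obtain rfl : f = T := funext h
  exact of_hasFDerivAt T.hasFDerivAt

end HasDifferential

/-! ### Differentials on the unreduced phase space and of the reduction map -/

section Quad

variable {y : Quad n}

theorem hasDifferential_L : HasDifferential (fun y : Quad n => y.L) y Quad.L :=
  .of_clm (ContinuousLinearMap.fst ℂ _ _) fun _ => rfl

theorem hasDifferential_U : HasDifferential (fun y : Quad n => y.U) y Quad.U :=
  .of_clm ((ContinuousLinearMap.fst ℂ _ _).comp (ContinuousLinearMap.snd ℂ _ _)) fun _ => rfl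

theorem hasDifferential_Φ₁ : HasDifferential (fun y : Quad n => y.Φ₁) y Quad.Φ₁ :=
  .of_clm ((ContinuousLinearMap.fst ℂ _ _).comp
    ((ContinuousLinearMap.snd ℂ _ _).comp (ContinuousLinearMap.snd ℂ _ _))) fun _ => rfl

theorem hasDifferential_Φ₃ : HasDifferential (fun y : Quad n => y.Φ₃) y Quad.Φ₃ :=
  .of_clm ((ContinuousLinearMap.snd ℂ _ _).comp
    ((ContinuousLinearMap.snd ℂ _ _).comp (ContinuousLinearMap.snd ℂ _ _))) fun _ => rfl

/-- The differential of `Λ⁻¹ Φ₁`. -/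
def dA (y v : Quad n) : Mat n := y.L⁻¹ * v.Φ₁ - y.L⁻¹ * v.L * (y.L⁻¹ * y.Φ₁)

/-- The differential of `U⁻¹ Φ₃`. -/
def dC (y v : Quad n) : Mat n := y.U⁻¹ * v.Φ₃ - y.U⁻¹ * v.U * (y.U⁻¹ * y.Φ₃)

theorem hasDifferential_A (hy : y ∈ phaseSpace n) :
    HasDifferential (fun y : Quad n => y.L⁻¹ * y.Φ₁) y (dA y) :=
  ((hasDifferential_L.inv hy.1).mul hasDifferential_Φ₁).congr_right fun v => by
    simp only [dA]; noncomm_ring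

theorem hasDifferential_C (hy : y ∈ phaseSpace n) :
    HasDifferential (fun y : Quad n => y.U⁻¹ * y.Φ₃) y (dC y) :=
  ((hasDifferential_U.inv hy.2).mul hasDifferential_Φ₃).congr_right fun v => by
    simp only [dC]; noncomm_ring

/-- The differential of the moment map of the conjugation action. -/
theorem hasDifferential_conjMoment (hy : y ∈ phaseSpace n) :
    HasDifferential conjMoment y
      (fun v => v.Φ₁ - (dA y v * y.L + y.L⁻¹ * y.Φ₁ * v.L) + v.Φ₃) :=
  (hasDifferential_Φ₁.sub ((hasDifferential_A hy).mul hasDifferential_L)).add hasDifferential_Φ₃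

theorem hasDifferential_frameMoment (hy : y ∈ phaseSpace n) :
    HasDifferential frameMoment y (fun v => dC y v * y.U + y.U⁻¹ * y.Φ₃ * v.U) :=
  (hasDifferential_C hy).mul hasDifferential_U

theorem nodeForm_eq (hy : y ∈ phaseSpace n) (v w : Quad n) :
    nodeForm y v w = ((dA y v * w.L).trace - (dA y w * v.L).trace)
      + ((dC y v * w.U).trace - (dC y w * v.U).trace) := by
  rw [← (hasDifferential_A hy).2, ← (hasDifferential_A hy).2, ← (hasDifferential_C hy).2,
    ← (hasDifferential_C hy).2, ← (hasDifferential_L (y := y)).2 v, ← (hasDifferential_L (y := y)).2 w,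
    ← (hasDifferential_U (y := y)).2 v, ← (hasDifferential_U (y := y)).2 w]
  rfl

theorem hasDifferential_moduliMap {m : Mat n × Mat n} (hU : IsUnit m.2.det) :
    HasDifferential moduliMap m
      (fun v => m.2⁻¹ * (v.1 + (m.1 * (v.2 * m.2⁻¹) - v.2 * m.2⁻¹ * m.1)) * m.2) := by
  have h1 : HasDifferential (fun m : Mat n × Mat n => m.1) m Prod.fst :=
    .of_clm (ContinuousLinearMap.fst ℂ _ _) fun _ => rfl
  have h2 : HasDifferential (fun m : Mat n × Mat n => m.2) m Prod.snd :=
    .of_clm (ContinuousLinearMap.snd ℂ _ _) fun _ => rfl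
  refine (((h2.inv hU).mul h1).mul h2).congr_right fun v => ?_
  -- Writing `δU = (δU U⁻¹) U` gives the last product-rule term the shape `U⁻¹ (⋯) U` of the others.
  have : v.2 = v.2 * m.2⁻¹ * m.2 := by rw [mul_assoc, Matrix.nonsing_inv_mul _ hU, mul_one]
  conv_lhs => rw [this]
  have e : m.2 * m.2⁻¹ = 1 := Matrix.mul_nonsing_inv _ hU
  simp only [mul_add, add_mul, mul_sub, sub_mul, mul_assoc, neg_mul, e, mul_one]
  abel

/-- The reduction map `(Λ, U, Φ₁, Φ₃) ↦ (U⁻¹ Λ U, U⁻¹ Λ⁻¹ Φ₁ U)` to the cotangent bundle of the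
moduli space. -/
def reductionMap (y : Quad n) : Cotangent n :=
  (moduliMap (y.L, y.U), y.U⁻¹ * (y.L⁻¹ * y.Φ₁) * y.U)

theorem hasFDerivAt_reductionMap (hy : y ∈ phaseSpace n) :
    DifferentiableAt ℂ reductionMap y ∧ ∀ v, fderiv ℂ reductionMap y v =
      (y.U⁻¹ * (v.L + (y.L * (v.U * y.U⁻¹) - v.U * y.U⁻¹ * y.L)) * y.U,
        y.U⁻¹ * (dA y v + (y.L⁻¹ * y.Φ₁ * (v.U * y.U⁻¹) - v.U * y.U⁻¹ * (y.L⁻¹ * y.Φ₁))) * y.U) := by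
  -- Both components are conjugates by `U`, of `Λ` and of `Λ⁻¹ Φ₁`, so one chain rule through
  -- `moduliMap` serves for both.
  have conj {F : Quad n → Mat n} {D : Quad n → Mat n} (hF : HasDifferential F y D) :
      HasDifferential (fun y => moduliMap (F y, y.U)) y (fun v =>
        y.U⁻¹ * (D v + (F y * (v.U * y.U⁻¹) - v.U * y.U⁻¹ * F y)) * y.U) := by
    have h := (hasDifferential_moduliMap (m := (F y, y.U)) hy.2)
    have h' := (h.1.hasFDerivAt.comp y (hF.1.hasFDerivAt.prodMk hasDifferential_U.1.hasFDerivAt))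
    refine (HasDifferential.of_hasFDerivAt h').congr_right fun v => ?_
    rw [← hF.2 v, ← (hasDifferential_U (y := y)).2 v]
    exact h.2 _
  have h1 := conj hasDifferential_L
  have h2 := conj (hasDifferential_A hy)
  have h := h1.1.hasFDerivAt.prodMk h2.1.hasFDerivAt
  refine ⟨h.differentiableAt, fun v => ?_⟩
  refine .trans ?_ (congrArg₂ Prod.mk (h1.2 v) (h2.2 v))
  exact congrArg (fun T : Quad n →L[ℂ] Cotangent n => T v) h.fderiv

/-- For a fixed tangent vector the canonical one-form is linear in the covector and independent of
the base point, hence equal to its own derivative. -/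
theorem canonicalForm_eq (q ξ η : Cotangent n) :
    canonicalForm q ξ η = (ξ.2 * η.1).trace - (η.2 * ξ.1).trace := by
  have key (ζ v : Cotangent n) :
      fderiv ℂ (fun y : Cotangent n => canonicalOneForm y ζ) q v = (v.2 * ζ.1).trace := by
    let T : Cotangent n →ₗ[ℂ] ℂ :=
      (Matrix.traceLinearMap (Fin n) ℂ ℂ).comp
        ((LinearMap.mulRight ℂ ζ.1).comp (LinearMap.snd ℂ (Mat n) (Mat n)))
    have : HasFDerivAt (fun y : Cotangent n => canonicalOneForm y ζ)
        (LinearMap.toContinuousLinearMap T) q := (LinearMap.toContinuousLinearMap T).hasFDerivAt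
    rw [this.fderiv]; rfl
  simp only [canonicalForm, extd, key]

end Quad

end Calculus

/-! ### The differentials restated without the auxiliary norm -/

section Frozen

variable {n : ℕ}

theorem fderiv_moduliMap {m : Mat n × Mat n} (hU : IsUnit m.2.det) :
    DifferentiableAt ℂ moduliMap m ∧ ∀ v, fderiv ℂ moduliMap m v =
      m.2⁻¹ * (v.1 + (m.1 * (v.2 * m.2⁻¹) - v.2 * m.2⁻¹ * m.1)) * m.2 :=
  hasDifferential_moduliMap hU

theorem fderiv_reductionMap {y : Quad n} (hy : y ∈ phaseSpace n) :
    DifferentiableAt ℂ reductionMap y ∧ ∀ v, fderiv ℂ reductionMap y v =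
      (y.U⁻¹ * (v.L + (y.L * (v.U * y.U⁻¹) - v.U * y.U⁻¹ * y.L)) * y.U,
        y.U⁻¹ * (dA y v + (y.L⁻¹ * y.Φ₁ * (v.U * y.U⁻¹) - v.U * y.U⁻¹ * (y.L⁻¹ * y.Φ₁))) * y.U) :=
  hasFDerivAt_reductionMap hy

theorem fderiv_conjMoment {y : Quad n} (hy : y ∈ phaseSpace n) (v : Quad n) :
    fderiv ℂ conjMoment y v = v.Φ₁ - (dA y v * y.L + y.L⁻¹ * y.Φ₁ * v.L) + v.Φ₃ :=
  (hasDifferential_conjMoment hy).2 v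

theorem fderiv_frameMoment {y : Quad n} (hy : y ∈ phaseSpace n) (v : Quad n) :
    fderiv ℂ frameMoment y v = dC y v * y.U + y.U⁻¹ * y.Φ₃ * v.U :=
  (hasDifferential_frameMoment hy).2 v

end Frozen

/-! ## The two Hamiltonian actions -/

section Hamiltonian

variable {n : ℕ}

theorem isUnit_det_coe (g : GL (Fin n) ℂ) : IsUnit (g : Mat n).det :=
  (Matrix.isUnit_iff_isUnit_det _).1 g.isUnit

theorem inv_mul_cancel_left' {A : Mat n} (hA : IsUnit A.det) (B : Mat n) : A⁻¹ * (A * B) = B :=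
  Matrix.nonsing_inv_mul_cancel_left _ _ hA

theorem mul_inv_cancel_left' {A : Mat n} (hA : IsUnit A.det) (B : Mat n) : A * (A⁻¹ * B) = B :=
  Matrix.mul_nonsing_inv_cancel_left _ _ hA

theorem oneForm_frameField (y : Quad n) (a : Mat n) :
    oneForm y (frameField a y) = (frameMoment y * a).trace := by
  have h : oneForm y (frameField a y) =
    (y.L⁻¹ * y.Φ₁ * 0).trace + (y.U⁻¹ * y.Φ₃ * (y.U * a)).trace := rfl
  simp only [h, frameMoment, mul_zero, trace_zero, zero_add, mul_assoc]

section Relations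

variable {y : Quad n} (hy : y ∈ phaseSpace n)

include hy

theorem Φ₁_eq : y.Φ₁ = y.L * (y.L⁻¹ * y.Φ₁) := (mul_inv_cancel_left' hy.1 _).symm

theorem Φ₃_eq : y.Φ₃ = y.U * (y.U⁻¹ * y.Φ₃) := (mul_inv_cancel_left' hy.2 _).symm

/-- Product rule for `Φ₁ = Λ (Λ⁻¹ Φ₁)`. Taking `Λ`, `A = Λ⁻¹ Φ₁` and their variations as variables
frees the trace identities below of inverses. -/
theorem dΦ₁_eq (v : Quad n) : v.Φ₁ = v.L * (y.L⁻¹ * y.Φ₁) + y.L * dA y v := by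
  simp only [dA, mul_sub, mul_assoc, mul_inv_cancel_left' hy.1]
  abel

theorem dΦ₃_eq (v : Quad n) : v.Φ₃ = v.U * (y.U⁻¹ * y.Φ₃) + y.U * dC y v := by
  simp only [dC, mul_sub, mul_assoc, mul_inv_cancel_left' hy.2]
  abel

/-- `Λ⁻¹ Φ₁` is transformed by conjugation, so its variation is a commutator. -/
theorem dA_conjField (a : Mat n) :
    dA y (conjField a y) = a * (y.L⁻¹ * y.Φ₁) - y.L⁻¹ * y.Φ₁ * a := by
  have h := Φ₁_eq hy
  set A := y.L⁻¹ * y.Φ₁ with hA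
  have : dA y (conjField a y) =
      y.L⁻¹ * (a * y.Φ₁ - y.Φ₁ * a) - y.L⁻¹ * (a * y.L - y.L * a) * A := rfl
  rw [this, h]
  simp only [mul_sub, sub_mul, mul_assoc, inv_mul_cancel_left' hy.1]
  abel

/-- `U⁻¹ Φ₃` becomes `U⁻¹ Φ₃ g⁻¹`, since the left factors `g` cancel. -/
theorem dC_conjField (a : Mat n) : dC y (conjField a y) = -(y.U⁻¹ * y.Φ₃ * a) := by
  have h := Φ₃_eq hy
  set C := y.U⁻¹ * y.Φ₃ with hC
  have : dC y (conjField a y) =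
      y.U⁻¹ * (a * y.Φ₃ - y.Φ₃ * a) - y.U⁻¹ * (a * y.U) * C := rfl
  rw [this, h]
  simp only [mul_sub, mul_assoc, inv_mul_cancel_left' hy.2]
  abel

/-- With `A = Λ⁻¹ Φ₁` and `C = U⁻¹ Φ₃`, cyclicity turns `Tr (A [a, Λ]) + Tr (C a U)` into `Tr ((Λ A
- A Λ + U C) a)`, and the three products are `Φ₁`, `Φ₂`, `Φ₃`. -/
theorem oneForm_conjField (a : Mat n) :
    oneForm y (conjField a y) = (conjMoment y * a).trace := by
  have h1 : oneForm y (conjField a y) = (y.L⁻¹ * y.Φ₁ * (a * y.L - y.L * a)).trace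
    + (y.U⁻¹ * y.Φ₃ * (a * y.U)).trace := rfl
  have h2 : conjMoment y = y.L * (y.L⁻¹ * y.Φ₁) - y.L⁻¹ * y.Φ₁ * y.L
      + y.U * (y.U⁻¹ * y.Φ₃) := by rw [← Φ₁_eq hy, ← Φ₃_eq hy]; rfl
  rw [h1, h2]
  generalize y.L⁻¹ * y.Φ₁ = A
  generalize y.U⁻¹ * y.Φ₃ = C
  have e1 := Matrix.trace_mul_comm (A * a) y.L
  have e2 := Matrix.trace_mul_comm (C * a) y.U
  simp only [mul_sub, sub_mul, add_mul, mul_assoc, trace_add, trace_sub] at *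
  linear_combination e1 + e2

theorem nodeForm_conjField (a : Mat n) (v : Quad n) :
    nodeForm y (conjField a y) v = -(fderiv ℂ conjMoment y v * a).trace := by
  rw [nodeForm_eq hy, fderiv_conjMoment hy, dA_conjField hy, dC_conjField hy, dΦ₁_eq hy v,
    dΦ₃_eq hy v]
  have h1 : (conjField a y).L = a * y.L - y.L * a := rfl
  have h2 : (conjField a y).U = a * y.U := rfl
  rw [h1, h2]
  generalize y.L⁻¹ * y.Φ₁ = A
  generalize y.U⁻¹ * y.Φ₃ = C
  generalize dA y v = A'
  generalize dC y v = C'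
  -- Both sides are now sums of traces of words in independent matrices; these are the cyclic
  -- rotations that match them.
  have e1 := Matrix.trace_mul_comm a (A * v.L)
  have e2 := Matrix.trace_mul_comm (A * a) v.L
  have e3 := Matrix.trace_mul_comm (A' * a) y.L
  have e4 := Matrix.trace_mul_comm (C * a) v.U
  have e5 := Matrix.trace_mul_comm (C' * a) y.U
  simp only [mul_sub, sub_mul, add_mul, neg_mul, mul_assoc, trace_add, trace_sub,
    trace_neg] at *
  linear_combination e1 - e2 - e3 - e4 - e5

theorem nodeForm_frameField (a : Mat n) (v : Quad n) :
    nodeForm y (frameField a y) v = -(fderiv ℂ frameMoment y v * a).trace := by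
  rw [nodeForm_eq hy, fderiv_frameMoment hy]
  have h1 : dA y (frameField a y) = y.L⁻¹ * 0 - y.L⁻¹ * 0 * (y.L⁻¹ * y.Φ₁) := rfl
  have h2 : dC y (frameField a y) = y.U⁻¹ * 0 - y.U⁻¹ * (y.U * a) * (y.U⁻¹ * y.Φ₃) := rfl
  have h3 : (frameField a y).L = 0 := rfl
  have h4 : (frameField a y).U = y.U * a := rfl
  rw [h1, h2, h3, h4]
  generalize y.U⁻¹ * y.Φ₃ = C
  generalize dC y v = C'
  have e1 := Matrix.trace_mul_comm a (C * v.U)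
  simp only [mul_zero, zero_mul, trace_zero, sub_zero, zero_sub, inv_mul_cancel_left' hy.2, add_mul,
    neg_mul, mul_assoc, trace_add, trace_neg] at *
  linear_combination -e1

theorem conjAct_mem_phaseSpace (g : GL (Fin n) ℂ) : conjAct g y ∈ phaseSpace n := by
  have hg := isUnit_det_coe g
  have hg' := isUnit_det_coe g⁻¹
  constructor
  · change IsUnit ((g : Mat n) * y.L * ((g⁻¹ : GL (Fin n) ℂ) : Mat n)).det
    simp only [det_mul]
    exact (hg.mul hy.1).mul hg'
  · change IsUnit ((g : Mat n) * y.U).det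
    simp only [det_mul]
    exact hg.mul hy.2

theorem frameAct_mem_phaseSpace (h : GL (Fin n) ℂ) : frameAct h y ∈ phaseSpace n := by
  refine ⟨hy.1, ?_⟩
  change IsUnit (y.U * (h : Mat n)).det
  rw [det_mul]
  exact hy.2.mul (isUnit_det_coe h)

/-- `conjAct g` is linear, so it also transports tangent vectors. It conjugates `Λ` and `Λ⁻¹ Φ₁`,
while `U⁻¹ Φ₃` acquires `g⁻¹` on the right and `U` acquires `g` on the left; the traces do not
change. -/
theorem nodeForm_conjAct (g : GL (Fin n) ℂ) (v w : Quad n) :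
    nodeForm (conjAct g y) (conjAct g v) (conjAct g w) = nodeForm y v w := by
  rw [nodeForm_eq (conjAct_mem_phaseSpace hy g), nodeForm_eq hy]
  set G : Mat n := (g : Mat n) with hG
  have hu : IsUnit G.det := isUnit_det_coe g
  have hi : ((g⁻¹ : GL (Fin n) ℂ) : Mat n) = G⁻¹ := Matrix.coe_units_inv g
  have hA (v : Quad n) : dA (conjAct g y) (conjAct g v) = G * dA y v * G⁻¹ := by
    change (G * y.L * ((g⁻¹ : GL (Fin n) ℂ) : Mat n))⁻¹ *
        (G * v.Φ₁ * ((g⁻¹ : GL (Fin n) ℂ) : Mat n)) -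
      (G * y.L * ((g⁻¹ : GL (Fin n) ℂ) : Mat n))⁻¹ * (G * v.L * ((g⁻¹ : GL (Fin n) ℂ) : Mat n)) *
      ((G * y.L * ((g⁻¹ : GL (Fin n) ℂ) : Mat n))⁻¹ *
        (G * y.Φ₁ * ((g⁻¹ : GL (Fin n) ℂ) : Mat n))) = _
    rw [hi]
    simp only [dA, Matrix.mul_inv_rev, Matrix.nonsing_inv_nonsing_inv _ hu, mul_assoc, mul_sub,
      sub_mul, inv_mul_cancel_left' hu]
  have hC (v : Quad n) : dC (conjAct g y) (conjAct g v) = dC y v * G⁻¹ := by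
    change (G * y.U)⁻¹ * (G * v.Φ₃ * ((g⁻¹ : GL (Fin n) ℂ) : Mat n)) -
      (G * y.U)⁻¹ * (G * v.U) * ((G * y.U)⁻¹ * (G * y.Φ₃ * ((g⁻¹ : GL (Fin n) ℂ) : Mat n))) = _
    rw [hi]
    simp only [dC, Matrix.mul_inv_rev, mul_assoc, sub_mul, inv_mul_cancel_left' hu]
  have hL (v : Quad n) : (conjAct g v).L = G * v.L * G⁻¹ := by rw [← hi]; rfl
  have hU (v : Quad n) : (conjAct g v).U = G * v.U := rfl
  have hT (A B : Mat n) : (G * A * G⁻¹ * (G * B * G⁻¹)).trace = (A * B).trace := by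
    have : G * A * G⁻¹ * (G * B * G⁻¹) = G * (A * B) * G⁻¹ := by
      simp only [mul_assoc, inv_mul_cancel_left' hu]
    rw [this, Matrix.trace_mul_comm, inv_mul_cancel_left' hu]
  have hT' (A B : Mat n) : A * G⁻¹ * (G * B) = A * B := by
    simp only [mul_assoc, inv_mul_cancel_left' hu]
  simp only [hA, hC, hL, hU, hT, hT']

/-- Only the second term is affected: `U⁻¹ Φ₃` acquires `h⁻¹` on the left and `U` acquires `h` on
the right, which cancel under the trace. -/
theorem nodeForm_frameAct (h : GL (Fin n) ℂ) (v w : Quad n) :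
    nodeForm (frameAct h y) (frameAct h v) (frameAct h w) = nodeForm y v w := by
  rw [nodeForm_eq (frameAct_mem_phaseSpace hy h), nodeForm_eq hy]
  set G : Mat n := (h : Mat n) with hG
  have hu : IsUnit G.det := isUnit_det_coe h
  have hA (v : Quad n) : dA (frameAct h y) (frameAct h v) = dA y v := rfl
  have hC (v : Quad n) : dC (frameAct h y) (frameAct h v) = G⁻¹ * dC y v := by
    change (y.U * G)⁻¹ * v.Φ₃ - (y.U * G)⁻¹ * (v.U * G) * ((y.U * G)⁻¹ * y.Φ₃) = _
    simp only [dC, Matrix.mul_inv_rev, mul_assoc, mul_sub, mul_inv_cancel_left' hu]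
  have hL (v : Quad n) : (frameAct h v).L = v.L := rfl
  have hU (v : Quad n) : (frameAct h v).U = v.U * G := rfl
  have hT (A B : Mat n) : (G⁻¹ * A * (B * G)).trace = (A * B).trace := by
    rw [Matrix.trace_mul_comm, mul_assoc, mul_inv_cancel_left' hu, Matrix.trace_mul_comm]
  simp only [hA, hC, hL, hU, hT]

end Relations

end Hamiltonian

/-! ## The moduli space of framed bundles -/

section Moduli

variable {n : ℕ}

theorem charpoly_conj {g : Mat n} (hg : IsUnit g.det) (A : Mat n) :
    (g * A * g⁻¹).charpoly = A.charpoly := by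
  obtain ⟨u, rfl⟩ := (Matrix.isUnit_iff_isUnit_det _).2 hg
  exact Matrix.charpoly_units_conj u A

theorem det_conj' {g : Mat n} (hg : IsUnit g.det) (A : Mat n) : (g * A * g⁻¹).det = A.det := by
  rw [det_mul, det_mul, mul_right_comm, ← det_mul, Matrix.mul_nonsing_inv _ hg, det_one, one_mul]

theorem conj_mem_principalCell {g : Mat n} (hg : IsUnit g.det) {A : Mat n}
    (hA : A ∈ principalCell n) : g * A * g⁻¹ ∈ principalCell n := by
  refine ⟨?_, ?_⟩
  · rw [det_conj' hg]; exact hA.1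
  · rw [charpoly_conj hg]; exact hA.2

theorem moduliMap_mem {m : Mat n × Mat n} (hm : m ∈ bundleData n) :
    moduliMap m ∈ principalCell n := by
  have h := conj_mem_principalCell (g := m.2⁻¹) ((Matrix.isUnit_nonsing_inv_det_iff).2 hm.2) hm.1
  rwa [Matrix.nonsing_inv_nonsing_inv _ hm.2] at h

theorem image_moduliMap : moduliMap '' bundleData n = principalCell n := by
  ext X
  constructor
  · rintro ⟨m, hm, rfl⟩
    exact moduliMap_mem hm
  · intro hX
    exact ⟨(X, 1), ⟨hX, by simp⟩, by simp [moduliMap]⟩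

theorem exists_mvPolynomial_principalCell (n : ℕ) : ∃ p : MvPolynomial (Fin n × Fin n) ℂ,
    ∀ A : Mat n, A.charpoly.roots.Nodup ↔ MvPolynomial.eval (fun ij => A ij.1 ij.2) p ≠ 0 := by
  -- The discriminant up to sign. The degrees `n` and `n - 1` are fixed in advance so that the
  -- resultant commutes with specialising the entries; in characteristic zero they are the true
  -- degrees, also for `n = 0` with truncated subtraction.
  refine ⟨(charpoly.univ ℂ (Fin n)).resultant (derivative (charpoly.univ ℂ (Fin n))) n (n - 1),
    fun A => ?_⟩
  have h0 : A.charpoly.Monic := Matrix.charpoly_monic A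
  have hd : A.charpoly.natDegree = n := by simp
  have hd' : (derivative A.charpoly).natDegree = n - 1 := by
    rw [Polynomial.natDegree_derivative, hd]
  have hm : (charpoly.univ ℂ (Fin n)).map (MvPolynomial.eval fun ij => A ij.1 ij.2) =
      A.charpoly := by
    have := charpoly.univ_map_eval₂Hom (Fin n) (RingHom.id ℂ) (fun ij => A ij.1 ij.2)
    exact this
  rw [← Polynomial.resultant_map_map, ← Polynomial.derivative_map, hm,
    nodup_roots_iff_of_splits h0.ne_zero (IsAlgClosed.splits _), Polynomial.Separable,
    ← isUnit_resultant_iff_isCoprime h0, hd, hd', isUnit_iff_ne_zero]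

theorem isOpen_principalCell : IsOpen (principalCell n) := by
  obtain ⟨p, hp⟩ := exists_mvPolynomial_principalCell n
  have : principalCell n = {A | A.det ≠ 0} ∩
      {A | MvPolynomial.eval (fun ij => A ij.1 ij.2) p ≠ 0} := by
    ext A
    simp [principalCell, hp]
  rw [this]
  have hc : Continuous fun A : Mat n => fun ij : Fin n × Fin n => A ij.1 ij.2 :=
    continuous_pi fun ij => continuous_id.matrix_elem ij.1 ij.2
  exact (isOpen_ne_fun (continuous_id.matrix_det) continuous_const).inter
    (isOpen_ne_fun (p.continuous_eval.comp hc) continuous_const)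

theorem surjective_fderiv_moduliMap {m : Mat n × Mat n} (hm : IsUnit m.2.det) :
    Function.Surjective (fderiv ℂ (moduliMap (n := n)) m) := by
  intro B
  -- Varying `Λ` alone suffices.
  refine ⟨(m.2 * B * m.2⁻¹, 0), ?_⟩
  rw [(fderiv_moduliMap hm).2]
  simp only [zero_mul, mul_zero, sub_zero, add_zero, mul_assoc, inv_mul_cancel_left' hm,
    Matrix.nonsing_inv_mul _ hm, mul_one]

theorem eval_mulVec (K : PolyMat n) (s : Fin n → ℂ[X]) (a : ℂ) :
    (fun i => ((K *ᵥ s) i).eval a) = evalMat a K *ᵥ fun i => (s i).eval a := by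
  funext i
  simp [Matrix.mulVec, dotProduct, evalMat, Polynomial.eval_finsetSum]

/-- The constant polynomial matrix. -/
def constMat (A : Mat n) : PolyMat n := A.map C

@[simp] theorem evalMat_constMat (a : ℂ) (A : Mat n) : evalMat a (constMat A) = A := by
  ext i j; simp [evalMat, constMat]

theorem natDegree_constMat (A : Mat n) (i j : Fin n) : (constMat A i j).natDegree = 0 := by
  simp [constMat]

theorem constMat_mul (A B : Mat n) : constMat (A * B) = constMat A * constMat B :=
  Matrix.map_mul

theorem constMat_one : constMat (1 : Mat n) = 1 :=
  Matrix.map_one _ (map_zero _) (map_one _)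

theorem constMat_evalMat {K : PolyMat n} (hK : ∀ i j, (K i j).natDegree = 0) (a : ℂ) :
    constMat (evalMat a K) = K := by
  ext1 i j
  obtain ⟨c, hc⟩ := Polynomial.natDegree_eq_zero.1 (hK i j)
  simp [constMat, evalMat, ← hc]

/-- Lagrange interpolation at the two preimages of the node. -/
theorem exists_eval_eq (N : MarkedNode) (a b : ℂ) :
    ∃ p : ℂ[X], p.eval N.z₁ = a ∧ p.eval N.z₂ = b := by
  have h := sub_ne_zero.2 N.ne₁₂
  refine ⟨C b + C ((a - b) / (N.z₁ - N.z₂)) * (X - C N.z₂), ?_, ?_⟩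
  · simp; field_simp; ring
  · simp

/-- The value at `z₂` is free and the gluing condition only prescribes the one at `z₁`. Such
sections test identities of matrices at the node. -/
theorem exists_mem_bundleModule (N : MarkedNode) (Λ : Mat n) (v : Fin n → ℂ) :
    ∃ s ∈ bundleModule N Λ, (fun i => (s i).eval N.z₂) = v := by
  choose s h1 h2 using fun i => exists_eval_eq N ((Λ *ᵥ v) i) (v i)
  have : (fun i => (s i).eval N.z₂) = v := funext h2
  exact ⟨s, by simp only [bundleModule, Set.mem_ofPred_eq, this]; exact funext h1, this⟩

/-- A polynomial matrix maps `M_Λ` into `M_Λ'` exactly when its values at the two preimages of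
the node are intertwined by the gluing maps. -/
theorem forall_mulVec_mem_iff (N : MarkedNode) (Λ Λ' : Mat n) (A : PolyMat n) :
    (∀ s ∈ bundleModule N Λ, A *ᵥ s ∈ bundleModule N Λ') ↔
      evalMat N.z₁ A * Λ = Λ' * evalMat N.z₂ A := by
  constructor
  · intro h
    refine Matrix.toLin'.injective (LinearMap.ext fun v => ?_)
    obtain ⟨s, hs, rfl⟩ := exists_mem_bundleModule N Λ v
    have := h s hs
    simp only [bundleModule, Set.mem_ofPred_eq, eval_mulVec] at this hs
    simp only [Matrix.toLin'_apply, ← Matrix.mulVec_mulVec, ← this, hs]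
  · intro h s hs
    simp only [bundleModule, Set.mem_ofPred_eq, eval_mulVec] at hs ⊢
    rw [hs, Matrix.mulVec_mulVec, h, Matrix.mulVec_mulVec]

theorem mem_endModule_iff (N : MarkedNode) (Λ : Mat n) (A : PolyMat n) :
    A ∈ endModule N Λ ↔ evalMat N.z₁ A * Λ = Λ * evalMat N.z₂ A :=
  forall_mulVec_mem_iff N Λ Λ A

/-- A constant `k` carries one framed bundle to the other exactly when `k Λ = Λ' k` and `k U = U'`.
The second equation gives `k = U' U⁻¹`, and the first then says that `U⁻¹ Λ U` is the same for both.
-/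
theorem framedIso_iff (N : MarkedNode) {m m' : Mat n × Mat n} (hm : IsUnit m.2.det)
    (hm' : IsUnit m'.2.det) : moduliMap m = moduliMap m' ↔ FramedIso N m m' := by
  constructor
  · intro h
    have h1 : m'.2 * m.2⁻¹ * (m.2 * m'.2⁻¹) = 1 := by
      simp only [mul_assoc, inv_mul_cancel_left' hm, Matrix.mul_nonsing_inv _ hm']
    have h2 : m.2 * m'.2⁻¹ * (m'.2 * m.2⁻¹) = 1 := by
      simp only [mul_assoc, inv_mul_cancel_left' hm', Matrix.mul_nonsing_inv _ hm]
    have hΛ : m'.2 * m.2⁻¹ * m.1 = m'.1 * (m'.2 * m.2⁻¹) := by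
      have := congrArg (fun X => m'.2 * X * m.2⁻¹) h
      simpa only [moduliMap, mul_assoc, mul_inv_cancel_left' hm', Matrix.mul_nonsing_inv _ hm,
        mul_one] using this
    have hΛ' : m.2 * m'.2⁻¹ * m'.1 = m.1 * (m.2 * m'.2⁻¹) := by
      have := congrArg (fun X => m.2 * X * m'.2⁻¹) h.symm
      simpa only [moduliMap, mul_assoc, mul_inv_cancel_left' hm, Matrix.mul_nonsing_inv _ hm',
        mul_one] using this
    refine ⟨⟨constMat (m'.2 * m.2⁻¹), constMat (m.2 * m'.2⁻¹), ?_, ?_⟩, ?_, ?_, ?_, ?_⟩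
    · rw [← constMat_mul, h1, constMat_one]
    · rw [← constMat_mul, h2, constMat_one]
    · exact natDegree_constMat _
    · exact natDegree_constMat _
    · intro s
      refine ⟨fun hs => ?_, fun hs => ?_⟩
      · exact (forall_mulVec_mem_iff N m.1 m'.1 _).2 (by simpa using hΛ) s hs
      · have := (forall_mulVec_mem_iff N m'.1 m.1 (constMat (m.2 * m'.2⁻¹))).2 (by simpa using hΛ')
          _ hs
        rwa [Matrix.mulVec_mulVec, ← constMat_mul, h2, constMat_one, Matrix.one_mulVec] at this
    · simp [mul_assoc, Matrix.nonsing_inv_mul _ hm]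
  · rintro ⟨K, hK, -, hs, hU⟩
    have h := (forall_mulVec_mem_iff N m.1 m'.1 (K : PolyMat n)).1 fun s h => (hs s).1 h
    have hc (a : ℂ) : evalMat a (K : PolyMat n) = evalMat N.z₃ (K : PolyMat n) := by
      rw [← constMat_evalMat hK N.z₃]; simp
    rw [hc, hc N.z₂] at h
    set k := evalMat N.z₃ (K : PolyMat n)
    have hk : IsUnit k.det := by
      have h' := hm'
      rw [← hU, det_mul] at h'
      exact isUnit_of_mul_isUnit_left h'
    rw [moduliMap, moduliMap, ← hU, Matrix.mul_inv_rev]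
    have h3 : m'.1 * k = k * m.1 := h.symm
    calc m.2⁻¹ * m.1 * m.2 = m.2⁻¹ * (k⁻¹ * (k * m.1)) * m.2 := by rw [inv_mul_cancel_left' hk]
      _ = m.2⁻¹ * k⁻¹ * m'.1 * (k * m.2) := by rw [← h3]; simp only [mul_assoc]

end Moduli

/-! ## The reduction at level zero -/

section Reduction

variable {n : ℕ} {y : Quad n}

theorem mem_phaseSpace_of_mem_zeroLevel (hy : y ∈ zeroLevel n) : y ∈ phaseSpace n :=
  ⟨hy.1.1.1, hy.1.2⟩

theorem conjMoment_eq (y : Quad n) : conjMoment y = y.Φ₁ - y.L⁻¹ * y.Φ₁ * y.L + y.Φ₃ := rfl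

/-- On the zero level, `Φ₃` is the commutator of `Λ⁻¹ Φ₁` and `Λ`. -/
theorem Φ₃_eq_of_mem_zeroLevel (hy : y ∈ zeroLevel n) :
    y.Φ₃ = y.L⁻¹ * y.Φ₁ * y.L - y.Φ₁ := by
  have h := hy.2
  rw [conjMoment_eq] at h
  rw [← sub_eq_zero, ← h]
  abel

theorem image_reductionMap :
    reductionMap '' zeroLevel n = {q : Cotangent n | q.1 ∈ principalCell n} := by
  ext q
  constructor
  · rintro ⟨y, hy, rfl⟩
    exact moduliMap_mem hy.1
  · intro hq
    have hu : IsUnit q.1.det := hq.1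
    -- The representative with `U = 1`: then `Λ = X`, `Φ₁ = X A`, and the constraint gives `Φ₃ = [A,
    -- X]`.
    refine ⟨(q.1, 1, q.1 * q.2, q.2 * q.1 - q.1 * q.2), ⟨⟨hq, by simp [Quad.U]⟩, ?_⟩, ?_⟩
    · change q.1 * q.2 - q.1⁻¹ * (q.1 * q.2) * q.1 + (q.2 * q.1 - q.1 * q.2) = 0
      rw [inv_mul_cancel_left' hu]
      abel
    · refine Prod.ext ?_ ?_
      · change (1 : Mat n)⁻¹ * q.1 * 1 = q.1
        simp
      · change (1 : Mat n)⁻¹ * (q.1⁻¹ * (q.1 * q.2)) * 1 = q.2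
        simp [inv_mul_cancel_left' hu]

/-- The framing leaves only `g = U' U⁻¹`. Equal images say that `g` conjugates `Λ` and `Λ⁻¹ Φ₁` to
their primed versions, and `Φ₁`, `Φ₃` are the product and the commutator of these two matrices. -/
theorem reductionMap_eq_iff (hy : y ∈ zeroLevel n) {y' : Quad n} (hy' : y' ∈ zeroLevel n) :
    reductionMap y = reductionMap y' ↔ ∃ g : GL (Fin n) ℂ, y' = conjAct g y := by
  have hp := mem_phaseSpace_of_mem_zeroLevel hy
  have hp' := mem_phaseSpace_of_mem_zeroLevel hy'
  constructor
  · intro h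
    obtain ⟨u, hu⟩ := (Matrix.isUnit_iff_isUnit_det _).2 hp.2
    obtain ⟨u', hu'⟩ := (Matrix.isUnit_iff_isUnit_det _).2 hp'.2
    have h1 : y.U⁻¹ * y.L * y.U = y'.U⁻¹ * y'.L * y'.U := congrArg Prod.fst h
    have h2 : y.U⁻¹ * (y.L⁻¹ * y.Φ₁) * y.U = y'.U⁻¹ * (y'.L⁻¹ * y'.Φ₁) * y'.U :=
      congrArg Prod.snd h
    have conj {X X' : Mat n} (h : y.U⁻¹ * X * y.U = y'.U⁻¹ * X' * y'.U) :
        X' = y'.U * y.U⁻¹ * X * (y.U * y'.U⁻¹) := by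
      have := congrArg (fun Z => y'.U * Z * y'.U⁻¹) h
      simpa only [mul_assoc, mul_inv_cancel_left' hp'.2, Matrix.mul_nonsing_inv _ hp'.2,
        mul_one, eq_comm] using this
    have hL := conj h1
    have hA := conj h2
    have hc (X : Mat n) : y.U * (y'.U⁻¹ * (y'.U * (y.U⁻¹ * X))) = X := by
      rw [inv_mul_cancel_left' hp'.2, mul_inv_cancel_left' hp.2]
    have hΦ₁ : y'.Φ₁ = y'.U * y.U⁻¹ * y.Φ₁ * (y.U * y'.U⁻¹) := by
      rw [Φ₁_eq hp', hA, hL]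
      simp only [mul_assoc, hc, mul_inv_cancel_left' hp.1]
    have hΦ₃ : y'.Φ₃ = y'.U * y.U⁻¹ * y.Φ₃ * (y.U * y'.U⁻¹) := by
      rw [Φ₃_eq_of_mem_zeroLevel hy', Φ₃_eq_of_mem_zeroLevel hy, hA, hL, hΦ₁]
      simp only [mul_assoc, mul_sub, sub_mul, hc]
    have hi : (((u' * u⁻¹)⁻¹ : GL (Fin n) ℂ) : Mat n) = y.U * y'.U⁻¹ := by
      rw [_root_.mul_inv_rev, inv_inv, Units.val_mul, Matrix.coe_units_inv, hu, hu']
    have hg : ((u' * u⁻¹ : GL (Fin n) ℂ) : Mat n) = y'.U * y.U⁻¹ := by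
      rw [Units.val_mul, Matrix.coe_units_inv, hu, hu']
    have hU : y'.U = y'.U * y.U⁻¹ * y.U := by
      rw [mul_assoc, Matrix.nonsing_inv_mul _ hp.2, mul_one]
    refine ⟨u' * u⁻¹, ?_⟩
    rw [conjAct, hi, hg]
    exact Prod.ext hL (Prod.ext hU (Prod.ext hΦ₁ hΦ₃))
  · rintro ⟨g, rfl⟩
    have hg := isUnit_det_coe g
    have hi : ((g⁻¹ : GL (Fin n) ℂ) : Mat n) = (g : Mat n)⁻¹ := Matrix.coe_units_inv g
    symm
    refine Prod.ext ?_ ?_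
    · change ((g : Mat n) * y.U)⁻¹ * ((g : Mat n) * y.L * ((g⁻¹ : GL (Fin n) ℂ) : Mat n)) *
        ((g : Mat n) * y.U) = y.U⁻¹ * y.L * y.U
      simp only [hi, Matrix.mul_inv_rev, mul_assoc, inv_mul_cancel_left' hg]
    · change ((g : Mat n) * y.U)⁻¹ *
        (((g : Mat n) * y.L * ((g⁻¹ : GL (Fin n) ℂ) : Mat n))⁻¹ *
          ((g : Mat n) * y.Φ₁ * ((g⁻¹ : GL (Fin n) ℂ) : Mat n))) *
        ((g : Mat n) * y.U) = y.U⁻¹ * (y.L⁻¹ * y.Φ₁) * y.U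
      simp only [hi, Matrix.mul_inv_rev, mul_assoc, inv_mul_cancel_left' hg,
        Matrix.nonsing_inv_nonsing_inv _ hg]

theorem reductionMap_submersion (hy : y ∈ phaseSpace n) (q : Cotangent n) :
    ∃ v : Quad n, fderiv ℂ conjMoment y v = 0 ∧ fderiv ℂ reductionMap y v = q := by
  obtain ⟨l, hl⟩ : ∃ l, l = y.U * q.1 * y.U⁻¹ := ⟨_, rfl⟩
  obtain ⟨a, ha⟩ : ∃ a, a = y.U * q.2 * y.U⁻¹ := ⟨_, rfl⟩
  set A := y.L⁻¹ * y.Φ₁ with hA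
  -- The lift has `δU = 0`: `δΛ` and `δ(Λ⁻¹ Φ₁)` are read off from `q`, `φ` is `δΦ₁` by the product
  -- rule, and `δΦ₃` is solved from the linearised constraint, where its coefficient is one.
  obtain ⟨φ, hφ⟩ : ∃ φ, φ = l * A + y.L * a := ⟨_, rfl⟩
  let v : Quad n := (l, 0, φ, -(φ - (a * y.L + A * l)))
  have hdA : dA y v = a := by
    change y.L⁻¹ * φ - y.L⁻¹ * l * A = a
    rw [hφ, mul_add, mul_assoc y.L⁻¹ l, inv_mul_cancel_left' hy.1]
    abel
  refine ⟨v, ?_, ?_⟩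
  · rw [fderiv_conjMoment hy, hdA]
    change φ - (a * y.L + A * l) + -(φ - (a * y.L + A * l)) = 0
    abel
  · rw [(fderiv_reductionMap hy).2, hdA]
    refine Prod.ext ?_ ?_
    · change y.U⁻¹ * (l + (y.L * (0 * y.U⁻¹) - 0 * y.U⁻¹ * y.L)) * y.U = q.1
      simp only [hl, zero_mul, mul_zero, sub_zero, add_zero, mul_assoc, inv_mul_cancel_left' hy.2,
        Matrix.nonsing_inv_mul _ hy.2, mul_one]
    · change y.U⁻¹ * (a + (A * (0 * y.U⁻¹) - 0 * y.U⁻¹ * A)) * y.U = q.2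
      simp only [ha, zero_mul, mul_zero, sub_zero, add_zero, mul_assoc, inv_mul_cancel_left' hy.2,
        Matrix.nonsing_inv_mul _ hy.2, mul_one]

theorem trace_conj_mul_conj {U : Mat n} (hU : IsUnit U.det) (A B : Mat n) :
    (U⁻¹ * A * U * (U⁻¹ * B * U)).trace = (A * B).trace := by
  have : U⁻¹ * A * U * (U⁻¹ * B * U) = U⁻¹ * (A * B) * U := by
    simp only [mul_assoc, mul_inv_cancel_left' hU]
  rw [this, Matrix.trace_mul_comm, mul_inv_cancel_left' hU]

/-- The framing part of `δX` contributes `Tr (A [Λ, u]) = Tr ([A, Λ] u)` with `A = Λ⁻¹ Φ₁` and `u =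
δU U⁻¹`, and `[A, Λ] = Φ₃` on the zero level. -/
theorem canonicalOneForm_reductionMap (hy : y ∈ zeroLevel n) (v : Quad n) :
    canonicalOneForm (reductionMap y) (fderiv ℂ reductionMap y v) = oneForm y v := by
  have hp := mem_phaseSpace_of_mem_zeroLevel hy
  have h3 := Φ₃_eq_of_mem_zeroLevel hy
  have h1 := Φ₁_eq hp
  rw [(fderiv_reductionMap hp).2, canonicalOneForm, reductionMap, trace_conj_mul_conj hp.2]
  have h4 : (y.U⁻¹ * y.Φ₃ * v.U).trace = (y.Φ₃ * (v.U * y.U⁻¹)).trace := by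
    rw [mul_assoc, Matrix.trace_mul_comm, mul_assoc]
  rw [oneForm, h4, h3]
  generalize v.U * y.U⁻¹ = u
  generalize y.L⁻¹ * y.Φ₁ = A at *
  rw [h1]
  have e1 := Matrix.trace_mul_comm (A * u) y.L
  simp only [mul_add, mul_sub, sub_mul, mul_assoc, trace_add, trace_sub] at *
  linear_combination -e1

/-- The constraint eliminates `Φ₃` and its linearisation eliminates `δΦ₃`. What remains is an
identity of traces of words in `Λ`, `Λ⁻¹ Φ₁`, their variations and the two matrices `δU U⁻¹`, true
up to cyclic rotation. -/
theorem canonicalForm_reductionMap (hy : y ∈ zeroLevel n) {v w : Quad n}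
    (hv : fderiv ℂ conjMoment y v = 0) (hw : fderiv ℂ conjMoment y w = 0) :
    canonicalForm (reductionMap y) (fderiv ℂ reductionMap y v) (fderiv ℂ reductionMap y w) =
      nodeForm y v w := by
  have hp := mem_phaseSpace_of_mem_zeroLevel hy
  have h3 := Φ₃_eq_of_mem_zeroLevel hy
  have h1 := Φ₁_eq hp
  have hT (v w : Quad n) : (dC y v * w.U).trace =
      (v.Φ₃ * (w.U * y.U⁻¹)).trace - (v.U * y.U⁻¹ * y.Φ₃ * (w.U * y.U⁻¹)).trace := by
    have e1 := Matrix.trace_mul_comm y.U⁻¹ (v.Φ₃ * w.U)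
    have e2 := Matrix.trace_mul_comm y.U⁻¹ (v.U * (y.U⁻¹ * (y.Φ₃ * w.U)))
    simp only [dC, sub_mul, trace_sub, mul_assoc] at *
    rw [e1, e2]
  have hd {v : Quad n} (hv : fderiv ℂ conjMoment y v = 0) :
      v.Φ₃ = dA y v * y.L + y.L⁻¹ * y.Φ₁ * v.L - (v.L * (y.L⁻¹ * y.Φ₁) + y.L * dA y v) := by
    rw [← dΦ₁_eq hp, ← sub_eq_zero, ← hv, fderiv_conjMoment hp]
    abel
  rw [(fderiv_reductionMap hp).2, (fderiv_reductionMap hp).2, canonicalForm_eq,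
    trace_conj_mul_conj hp.2, trace_conj_mul_conj hp.2, nodeForm_eq hp, hT, hT, hd hv, hd hw, h3]
  generalize v.U * y.U⁻¹ = u
  generalize w.U * y.U⁻¹ = u'
  generalize dA y v = a
  generalize dA y w = a'
  generalize y.L⁻¹ * y.Φ₁ = A at *
  generalize v.L = l
  generalize w.L = l'
  rw [h1]
  generalize y.L = L
  have e1 := Matrix.trace_mul_comm (a * u') L
  have e1' := Matrix.trace_mul_comm (a' * u) L
  have e2 := Matrix.trace_mul_comm (A * u) l'
  have e2' := Matrix.trace_mul_comm (A * u') l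
  have e3 := Matrix.trace_mul_comm u (A * l')
  have e3' := Matrix.trace_mul_comm u' (A * l)
  have e4 := Matrix.trace_mul_comm u' (A * u * L)
  have e4' := Matrix.trace_mul_comm u (A * u' * L)
  have e5 := Matrix.trace_mul_comm (A * u) (u' * L)
  have e5' := Matrix.trace_mul_comm (A * u') (u * L)
  simp only [mul_add, add_mul, mul_sub, sub_mul, mul_assoc, trace_add, trace_sub] at *
  linear_combination -e1 + e1' + e2 - e2' - e3 + e3' - e4 + e4' - e5 + e5'

end Reduction

/-! ## Rational functions: degree, partial fractions, residues -/

section Residues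

open scoped LaurentSeries

/-- Rational functions of degree at most `d`. -/
def degLE (d : ℤ) : Submodule ℂ (RatFunc ℂ) where
  carrier := {f | f = 0 ∨ f.intDegree ≤ d}
  add_mem' := by
    intro f g hf hg
    by_cases h : f + g = 0
    · exact .inl h
    rcases eq_or_ne g 0 with rfl | hg0
    · simpa using hf
    rcases hf with rfl | hf
    · simpa using hg
    rcases hg with rfl | hg
    · exact absurd rfl hg0
    exact .inr ((RatFunc.intDegree_add_le hg0 h).trans (max_le hf hg))
  zero_mem' := .inl rfl
  smul_mem' := by
    intro c f hf
    rcases eq_or_ne c 0 with rfl | hc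
    · exact .inl (zero_smul _ _)
    rcases eq_or_ne f 0 with rfl | h0
    · exact .inl (smul_zero _)
    rcases hf with rfl | hf
    · exact .inl (smul_zero _)
    right
    rw [RatFunc.smul_eq_C_mul, RatFunc.intDegree_mul (by simpa using hc) h0, RatFunc.intDegree_C]
    simpa using hf

theorem degLE_mono {d e : ℤ} (h : d ≤ e) {f : RatFunc ℂ} (hf : f ∈ degLE d) : f ∈ degLE e :=
  hf.imp id fun h' => h'.trans h

theorem mul_mem_degLE {d e k : ℤ} (hk : d + e = k) {f g : RatFunc ℂ} (hf : f ∈ degLE d)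
    (hg : g ∈ degLE e) : f * g ∈ degLE k := by
  rcases eq_or_ne f 0 with rfl | hf0
  · simp
  rcases eq_or_ne g 0 with rfl | hg0
  · simp
  rcases hf with rfl | hf
  · exact absurd rfl hf0
  rcases hg with rfl | hg
  · exact absurd rfl hg0
  right
  rw [RatFunc.intDegree_mul hf0 hg0]
  omega

theorem X_mem_degLE : (RatFunc.X : RatFunc ℂ) ∈ degLE 1 := .inr (by simp)

theorem polynomial_eq_zero_of_mem_degLE {p : ℂ[X]}
    (h : algebraMap ℂ[X] (RatFunc ℂ) p ∈ degLE (-1)) : p = 0 := by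
  rcases h with h | h
  · simpa using h
  · rw [RatFunc.intDegree_polynomial] at h
    omega

/-- The rational function `1 / (z - a)`. -/
def pole (a : ℂ) : RatFunc ℂ := (RatFunc.X - RatFunc.C a)⁻¹

theorem algebraMap_X_sub_C (a : ℂ) :
    algebraMap ℂ[X] (RatFunc ℂ) (X - C a) = RatFunc.X - RatFunc.C a := by simp

theorem X_sub_C_ne_zero' (a : ℂ) : (RatFunc.X - RatFunc.C a : RatFunc ℂ) ≠ 0 := by
  rw [← algebraMap_X_sub_C]
  exact (map_ne_zero_iff _ (RatFunc.algebraMap_injective ℂ)).2 (Polynomial.X_sub_C_ne_zero a)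

theorem X_sub_C_mul_pole (a : ℂ) : (RatFunc.X - RatFunc.C a) * pole a = 1 :=
  mul_inv_cancel₀ (X_sub_C_ne_zero' a)

theorem X_mul_pole (a : ℂ) : RatFunc.X * pole a = 1 + a • pole a := by
  rw [RatFunc.smul_eq_C_mul, ← X_sub_C_mul_pole a]
  ring

theorem pole_mul_pole {a b : ℂ} (h : a ≠ b) :
    pole a * pole b = (a - b)⁻¹ • (pole a - pole b) := by
  have ha := X_sub_C_ne_zero' a
  have hb := X_sub_C_ne_zero' b
  have hc : (RatFunc.C (a - b) : RatFunc ℂ) ≠ 0 := by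
    exact (map_ne_zero_iff _ RatFunc.C.injective).2 (sub_ne_zero.2 h)
  rw [RatFunc.smul_eq_C_mul, map_inv₀, eq_inv_mul_iff_mul_eq₀ hc, pole, pole, map_sub]
  field_simp
  ring

theorem pole_mem_degLE (a : ℂ) : pole a ∈ degLE (-1) := by
  right
  rw [pole, ← algebraMap_X_sub_C, RatFunc.intDegree_inv, RatFunc.intDegree_polynomial]
  simp

/-- Partial fractions with poles in `Z`. -/
def partialFractions (Z : Set ℂ) : Submodule ℂ (RatFunc ℂ) :=
  Submodule.span ℂ ({f | ∃ k : ℕ, f = RatFunc.X ^ k} ∪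
    {f | ∃ a ∈ Z, ∃ k : ℕ, f = pole a ^ (k + 1)})

section PartialFractions

variable {Z : Set ℂ}

theorem X_pow_mem (k : ℕ) : RatFunc.X ^ k ∈ partialFractions Z :=
  Submodule.subset_span (.inl ⟨k, rfl⟩)

theorem pole_pow_mem {a : ℂ} (ha : a ∈ Z) (k : ℕ) : pole a ^ k ∈ partialFractions Z := by
  cases k with
  | zero => simpa using X_pow_mem (Z := Z) 0
  | succ k => exact Submodule.subset_span (.inr ⟨a, ha, k, rfl⟩)

theorem mul_mem_of_generators {g : RatFunc ℂ}
    (h1 : ∀ k : ℕ, g * RatFunc.X ^ k ∈ partialFractions Z)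
    (h2 : ∀ a ∈ Z, ∀ k : ℕ, g * pole a ^ (k + 1) ∈ partialFractions Z) {f : RatFunc ℂ}
    (hf : f ∈ partialFractions Z) : g * f ∈ partialFractions Z := by
  induction hf using Submodule.span_induction with
  | mem f hf =>
    rcases hf with ⟨k, rfl⟩ | ⟨a, ha, k, rfl⟩
    · exact h1 k
    · exact h2 a ha k
  | zero => simp
  | add f g _ _ hf hg => rw [mul_add]; exact add_mem hf hg
  | smul c f _ hf => rw [mul_smul_comm]; exact Submodule.smul_mem _ c hf

/-- Induction on the exponent: `z / (z - b) = 1 + b / (z - b)` lowers powers of `z`, and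
`pole_mul_pole` separates two distinct poles. -/
theorem pole_mul_mem {b : ℂ} (hb : b ∈ Z) {f : RatFunc ℂ} (hf : f ∈ partialFractions Z) :
    pole b * f ∈ partialFractions Z := by
  refine mul_mem_of_generators (fun k => ?_) (fun a ha k => ?_) hf
  · induction k with
    | zero => simpa using pole_pow_mem hb 1
    | succ k ih =>
      have : pole b * RatFunc.X ^ (k + 1) = RatFunc.X ^ k + b • (pole b * RatFunc.X ^ k) := by
        rw [pow_succ', ← mul_assoc, mul_comm (pole b), X_mul_pole, add_mul, one_mul,
          smul_mul_assoc]
      rw [this]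
      exact add_mem (X_pow_mem k) (Submodule.smul_mem _ _ ih)
  · rcases eq_or_ne a b with rfl | hab
    · rw [← pow_succ']
      exact pole_pow_mem ha _
    · induction k with
      | zero =>
        rw [zero_add, pow_one, pole_mul_pole hab.symm]
        refine Submodule.smul_mem _ _ (sub_mem ?_ ?_)
        · simpa using pole_pow_mem hb 1
        · simpa using pole_pow_mem ha 1
      | succ k ih =>
        have : pole b * pole a ^ (k + 1 + 1) =
            (b - a)⁻¹ • (pole b * pole a ^ (k + 1) - pole a ^ (k + 1 + 1)) := by
          rw [pow_succ' (pole a) (k + 1), ← mul_assoc, pole_mul_pole hab.symm, smul_mul_assoc,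
            sub_mul]
        rw [this]
        exact Submodule.smul_mem _ _ (sub_mem ih (pole_pow_mem ha _))

theorem algebraMap_mem_partialFractions (p : ℂ[X]) :
    algebraMap ℂ[X] (RatFunc ℂ) p ∈ partialFractions Z := by
  induction p using Polynomial.induction_on' with
  | add p q hp hq => rw [map_add]; exact add_mem hp hq
  | monomial k c =>
    have : algebraMap ℂ[X] (RatFunc ℂ) (monomial k c) = c • RatFunc.X ^ k := by
      rw [← Polynomial.C_mul_X_pow_eq_monomial, map_mul, map_pow, RatFunc.algebraMap_X,
        RatFunc.algebraMap_C, RatFunc.smul_eq_C_mul]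
    rw [this]
    exact Submodule.smul_mem _ _ (X_pow_mem k)

/-- Partial fraction decomposition. -/
theorem mem_partialFractions {f : RatFunc ℂ} (hf : ∀ a, f.denom.eval a = 0 → a ∈ Z) :
    f ∈ partialFractions Z := by
  -- The monic denominator splits, so `f` is its numerator times a product of factors `1 / (z - a)`,
  -- which are multiplied in one at a time.
  have key (m : Multiset ℂ) (hm : ∀ a ∈ m, a ∈ Z) :
      algebraMap ℂ[X] (RatFunc ℂ) f.num * (m.map pole).prod ∈ partialFractions Z := by
    induction m using Multiset.induction_on with
    | empty => simpa using algebraMap_mem_partialFractions f.num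
    | cons a m ih =>
      rw [Multiset.map_cons, Multiset.prod_cons, mul_left_comm]
      exact pole_mul_mem (hm a (Multiset.mem_cons_self a m))
        (ih fun b hb => hm b (Multiset.mem_cons_of_mem hb))
  have hd : algebraMap ℂ[X] (RatFunc ℂ) f.denom * (f.denom.roots.map pole).prod = 1 := by
    conv_lhs =>
      enter [1]
      rw [(IsAlgClosed.splits f.denom).eq_prod_roots_of_monic f.monic_denom, map_multiset_prod,
        Multiset.map_map]
    rw [← Multiset.prod_map_mul]
    refine Multiset.prod_eq_one fun x hx => ?_
    obtain ⟨a, -, rfl⟩ := Multiset.mem_map.1 hx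
    rw [Function.comp_apply, algebraMap_X_sub_C, X_sub_C_mul_pole]
  have h := key f.denom.roots fun a ha => hf a (Polynomial.isRoot_of_mem_roots ha)
  rw [eq_inv_of_mul_eq_one_right hd, ← div_eq_mul_inv, RatFunc.num_div_denom] at h
  exact h

end PartialFractions

theorem laurentSeries_algebraMap (p : ℂ[X]) :
    ((algebraMap ℂ[X] (RatFunc ℂ) p : RatFunc ℂ) : LaurentSeries ℂ) =
      ((p : PowerSeries ℂ) : LaurentSeries ℂ) :=
  (RatFunc.coe_coe p).symm

/-- The residue at `a` as a linear form. -/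
def residueLin (a : ℂ) : RatFunc ℂ →ₗ[ℂ] ℂ where
  toFun := residueAt a
  map_add' f g := by simp [residueAt]
  map_smul' c f := by
    have : ((RatFunc.C c : RatFunc ℂ) : LaurentSeries ℂ) = HahnSeries.C c := by
      rw [← RatFunc.algebraMap_C, laurentSeries_algebraMap]
      simp
    simp [residueAt, RatFunc.smul_eq_C_mul, RatFunc.laurent_C, this, -map_smul]

theorem residueLin_apply (a : ℂ) (f : RatFunc ℂ) : residueLin a f = residueAt a f := rfl

/-- After translating `a` to the origin the denominator is an invertible power series, so the
Laurent expansion has no negative powers. -/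
theorem residueLin_of_regular {a : ℂ} {p q : ℂ[X]} (hq : q.eval a ≠ 0) :
    residueLin a (algebraMap ℂ[X] (RatFunc ℂ) p / algebraMap ℂ[X] (RatFunc ℂ) q) = 0 := by
  rw [residueLin_apply, residueAt, RatFunc.laurent_div, map_div₀, laurentSeries_algebraMap,
    laurentSeries_algebraMap]
  set P : PowerSeries ℂ := ((taylor a p : ℂ[X]) : PowerSeries ℂ)
  set Q : PowerSeries ℂ := ((taylor a q : ℂ[X]) : PowerSeries ℂ) with hQ
  have h0 : PowerSeries.constantCoeff Q ≠ 0 := by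
    rw [hQ, Polynomial.constantCoeff_coe, Polynomial.taylor_coeff_zero]
    exact hq
  have hQ' : ((Q : PowerSeries ℂ) : LaurentSeries ℂ) ≠ 0 := by
    intro h
    have : Q = 0 := HahnSeries.ofPowerSeries_injective (Γ := ℤ) (by simpa using h)
    simp [this] at h0
  have : ((P : PowerSeries ℂ) : LaurentSeries ℂ) / (Q : LaurentSeries ℂ) =
      ((P * Q⁻¹ : PowerSeries ℂ) : LaurentSeries ℂ) := by
    rw [div_eq_iff hQ', ← PowerSeries.coe_mul, mul_assoc, PowerSeries.inv_mul_cancel _ h0, mul_one]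
  rw [this, PowerSeries.coeff_coe]
  simp

theorem residueLin_algebraMap (a : ℂ) (p : ℂ[X]) :
    residueLin a (algebraMap ℂ[X] (RatFunc ℂ) p) = 0 := by
  simpa using residueLin_of_regular (a := a) (p := p) (q := 1) (by simp)

theorem residueLin_pole_pow_of_ne {a b : ℂ} (h : a ≠ b) (k : ℕ) :
    residueLin b (pole a ^ k) = 0 := by
  have : pole a ^ k =
      algebraMap ℂ[X] (RatFunc ℂ) 1 / algebraMap ℂ[X] (RatFunc ℂ) ((X - C a) ^ k) := by
    rw [map_pow, algebraMap_X_sub_C, map_one, pole, inv_pow, one_div]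
  rw [this]
  exact residueLin_of_regular (by simpa using pow_ne_zero k (sub_ne_zero.2 h.symm))

theorem residueLin_pole_pow_self (a : ℂ) (k : ℕ) :
    residueLin a (pole a ^ k) = if k = 1 then 1 else 0 := by
  have h1 : RatFunc.laurent a (pole a ^ k) = (RatFunc.X ^ k)⁻¹ := by
    rw [map_pow, pole, map_inv₀, map_sub, RatFunc.laurent_X, RatFunc.laurent_C,
      add_sub_cancel_right, inv_pow]
  rw [residueLin_apply, residueAt, h1, map_inv₀, map_pow, RatFunc.coe_X, HahnSeries.single_pow,
    HahnSeries.inv_single, HahnSeries.coeff_single]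
  rcases eq_or_ne k 1 with rfl | hk
  · simp
  · have : (1 : ℤ) ≠ k := by omega
    simp [hk, this]

theorem residueLin_pole_self (a : ℂ) : residueLin a (pole a) = 1 := by
  simpa using residueLin_pole_pow_self a 1

theorem residueLin_pole_of_ne {a b : ℂ} (h : a ≠ b) : residueLin b (pole a) = 0 := by
  simpa using residueLin_pole_pow_of_ne h 1

/-- A polynomial divided by `z - a`. -/
theorem exists_mul_pole_eq (p : ℂ[X]) (a : ℂ) : ∃ q : ℂ[X],
    algebraMap ℂ[X] (RatFunc ℂ) p * pole a =
      algebraMap ℂ[X] (RatFunc ℂ) q + p.eval a • pole a := by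
  refine ⟨p /ₘ (X - C a), ?_⟩
  have h := Polynomial.modByMonic_add_div p (X - C a)
  rw [Polynomial.modByMonic_X_sub_C_eq_C_eval] at h
  conv_lhs => rw [← h]
  rw [map_add, map_mul, algebraMap_X_sub_C, RatFunc.algebraMap_C, add_mul, mul_right_comm,
    X_sub_C_mul_pole, one_mul, RatFunc.smul_eq_C_mul, add_comm]

end Residues

/-! ### The residue theorem and evaluation by residues -/

section SumOfResidues

variable (N : MarkedNode)

theorem pole_pow_mem_degLE (a : ℂ) (k : ℕ) : pole a ^ k ∈ degLE (-(k : ℤ)) := by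
  induction k with
  | zero => exact .inr (by simp)
  | succ k ih =>
    rw [pow_succ]
    exact mul_mem_degLE (by push_cast; ring) ih (pole_mem_degLE a)

theorem pole_sub_pole_mem_degLE (a b : ℂ) : pole a - pole b ∈ degLE (-2) := by
  rcases eq_or_ne a b with rfl | h
  · simp
  · have : pole a - pole b = (a - b) • (pole a * pole b) := by
      rw [pole_mul_pole h, smul_smul, mul_inv_cancel₀ (sub_ne_zero.2 h), one_smul]
    rw [this]
    exact Submodule.smul_mem _ _ (mul_mem_degLE (by norm_num) (pole_mem_degLE a) (pole_mem_degLE b))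

/-- The combination of the three simple poles with the given residues. -/
def simplePoles (c : ℂ × ℂ × ℂ) : RatFunc ℂ :=
  c.1 • pole N.z₁ + c.2.1 • pole N.z₂ + c.2.2 • pole N.z₃

theorem simplePoles_add (c d : ℂ × ℂ × ℂ) :
    simplePoles N (c + d) = simplePoles N c + simplePoles N d := by
  simp only [simplePoles, Prod.fst_add, Prod.snd_add, add_smul]
  ring

theorem simplePoles_smul (t : ℂ) (c : ℂ × ℂ × ℂ) :
    simplePoles N (t • c) = t • simplePoles N c := by
  simp only [simplePoles, Prod.smul_fst, Prod.smul_snd, smul_add, smul_smul, smul_eq_mul]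

theorem simplePoles_mem_degLE (c : ℂ × ℂ × ℂ) : simplePoles N c ∈ degLE (-1) :=
  add_mem (add_mem (Submodule.smul_mem _ _ (pole_mem_degLE _))
    (Submodule.smul_mem _ _ (pole_mem_degLE _))) (Submodule.smul_mem _ _ (pole_mem_degLE _))

theorem simplePoles_mem_degLE_of_sum {c : ℂ × ℂ × ℂ} (hc : c.1 + c.2.1 + c.2.2 = 0) :
    simplePoles N c ∈ degLE (-2) := by
  have : simplePoles N c =
      c.1 • (pole N.z₁ - pole N.z₃) + c.2.1 • (pole N.z₂ - pole N.z₃) := by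
    have h : c.2.2 = -c.1 - c.2.1 := by linear_combination hc
    simp only [simplePoles, h, smul_sub, sub_smul, neg_smul]
    ring
  rw [this]
  exact add_mem (Submodule.smul_mem _ _ (pole_sub_pole_mem_degLE _ _))
    (Submodule.smul_mem _ _ (pole_sub_pole_mem_degLE _ _))

/-- The poles are `O(1/z)`, so a polynomial part would spoil the decay. After multiplication by `z`
the poles contribute the sum of the residues plus `O(1/z)`, so that sum must vanish too. -/
theorem eq_zero_of_mem_degLE {p : ℂ[X]} {c : ℂ × ℂ × ℂ}
    (h : algebraMap ℂ[X] (RatFunc ℂ) p + simplePoles N c ∈ degLE (-2)) :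
    p = 0 ∧ c.1 + c.2.1 + c.2.2 = 0 := by
  have hp : p = 0 := by
    apply polynomial_eq_zero_of_mem_degLE
    have := sub_mem (degLE_mono (by norm_num : (-2 : ℤ) ≤ -1) h) (simplePoles_mem_degLE N c)
    rwa [add_sub_cancel_right] at this
  refine ⟨hp, ?_⟩
  rw [hp, map_zero, zero_add] at h
  have h1 : RatFunc.X * simplePoles N c ∈ degLE (-1) :=
    mul_mem_degLE (by norm_num) X_mem_degLE h
  have h2 : RatFunc.X * simplePoles N c = algebraMap ℂ[X] (RatFunc ℂ) (C (c.1 + c.2.1 + c.2.2)) +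
      simplePoles N (c.1 * N.z₁, c.2.1 * N.z₂, c.2.2 * N.z₃) := by
    simp only [simplePoles, mul_add, mul_smul_comm, X_mul_pole, smul_add, smul_smul]
    simp only [RatFunc.algebraMap_C, RatFunc.smul_eq_C_mul, map_add, mul_one]
    ring
  rw [h2] at h1
  have h3 := sub_mem h1 (simplePoles_mem_degLE N (c.1 * N.z₁, c.2.1 * N.z₂, c.2.2 * N.z₃))
  rw [add_sub_cancel_right] at h3
  exact Polynomial.C_eq_zero.1 (polynomial_eq_zero_of_mem_degLE h3)

theorem residueLin_simplePoles (c : ℂ × ℂ × ℂ) :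
    residueLin N.z₁ (simplePoles N c) = c.1 ∧ residueLin N.z₂ (simplePoles N c) = c.2.1 ∧
      residueLin N.z₃ (simplePoles N c) = c.2.2 := by
  simp only [simplePoles, map_add, map_smul, residueLin_pole_self,
    residueLin_pole_of_ne N.ne₁₂, residueLin_pole_of_ne N.ne₁₃, residueLin_pole_of_ne N.ne₂₃,
    residueLin_pole_of_ne N.ne₁₂.symm, residueLin_pole_of_ne N.ne₁₃.symm,
    residueLin_pole_of_ne N.ne₂₃.symm]
  simp

/-- The sum of the residues at the three special points. -/
def resSum : RatFunc ℂ →ₗ[ℂ] ℂ := residueLin N.z₁ + residueLin N.z₂ + residueLin N.z₃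

theorem resSum_simplePoles (c : ℂ × ℂ × ℂ) :
    resSum N (simplePoles N c) = c.1 + c.2.1 + c.2.2 := by
  obtain ⟨h1, h2, h3⟩ := residueLin_simplePoles N c
  simp [resSum, h1, h2, h3]

theorem resSum_algebraMap (p : ℂ[X]) : resSum N (algebraMap ℂ[X] (RatFunc ℂ) p) = 0 := by
  simp [resSum, residueLin_algebraMap]

variable {N}

/-- Poles of order at least two have no residue and decay like `z⁻²`; they are collected in `h`. -/
theorem exists_decomposition {f : RatFunc ℂ} (hf : RegularOff N f) :
    ∃ (p : ℂ[X]) (c : ℂ × ℂ × ℂ) (h : RatFunc ℂ),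
      f = algebraMap ℂ[X] (RatFunc ℂ) p + simplePoles N c + h ∧ h ∈ degLE (-2) ∧
        resSum N h = 0 := by
  have hm : f ∈ partialFractions {N.z₁, N.z₂, N.z₃} := by
    refine mem_partialFractions fun a ha => ?_
    by_contra hn
    simp only [Set.mem_insert_iff, Set.mem_singleton_iff, not_or] at hn
    exact hf a hn.1 hn.2.1 hn.2.2 ha
  clear hf
  induction hm using Submodule.span_induction with
  | mem f hf =>
    rcases hf with ⟨k, rfl⟩ | ⟨a, ha, k, rfl⟩
    · exact ⟨X ^ k, 0, 0, by simp [simplePoles], zero_mem _, map_zero _⟩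
    · cases k with
      | zero =>
        rcases ha with rfl | rfl | rfl
        · exact ⟨0, (1, 0, 0), 0, by simp [simplePoles], zero_mem _, map_zero _⟩
        · exact ⟨0, (0, 1, 0), 0, by simp [simplePoles], zero_mem _, map_zero _⟩
        · exact ⟨0, (0, 0, 1), 0, by simp [simplePoles], zero_mem _, map_zero _⟩
      | succ k =>
        have hr (b : ℂ) : residueLin b (pole a ^ (k + 1 + 1)) = 0 := by
          rcases eq_or_ne a b with rfl | hab
          · rw [residueLin_pole_pow_self, if_neg (by omega)]
          · exact residueLin_pole_pow_of_ne hab _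
        refine ⟨0, 0, pole a ^ (k + 1 + 1), by simp [simplePoles],
          degLE_mono (by push_cast; omega) (pole_pow_mem_degLE a (k + 1 + 1)), by
            simp [resSum, hr]⟩
  | zero => exact ⟨0, 0, 0, by simp [simplePoles], zero_mem _, map_zero _⟩
  | add f g _ _ hf hg =>
    obtain ⟨p, c, h, rfl, hd, hr⟩ := hf
    obtain ⟨p', c', h', rfl, hd', hr'⟩ := hg
    refine ⟨p + p', c + c', h + h', ?_, add_mem hd hd', by rw [map_add, hr, hr', add_zero]⟩
    rw [map_add, simplePoles_add]
    ring
  | smul t f _ hf =>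
    obtain ⟨p, c, h, rfl, hd, hr⟩ := hf
    refine ⟨C t * p, t • c, t • h, ?_, Submodule.smul_mem _ _ hd, by rw [map_smul, hr, smul_zero]⟩
    rw [simplePoles_smul, smul_add, smul_add, map_mul, RatFunc.algebraMap_C,
      ← RatFunc.smul_eq_C_mul]

/-- The residue theorem for a differential that is regular at infinity. -/
theorem resSum_eq_zero {f : RatFunc ℂ} (hf : RegularOff N f) (hd : f ∈ degLE (-2)) :
    resSum N f = 0 := by
  obtain ⟨p, c, h, rfl, hh, hr⟩ := exists_decomposition hf
  have := sub_mem hd hh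
  rw [add_sub_cancel_right] at this
  rw [map_add, map_add, resSum_algebraMap, resSum_simplePoles, hr, (eq_zero_of_mem_degLE N this).2]
  simp

theorem RegularOff.mul {f g : RatFunc ℂ} (hf : RegularOff N f) (hg : RegularOff N g) :
    RegularOff N (f * g) :=
  .of_dvd (RatFunc.denom_mul_dvd f g) hf hg

theorem regularOff_pole {a : ℂ} (ha : a = N.z₁ ∨ a = N.z₂ ∨ a = N.z₃) :
    RegularOff N (pole a) := by
  intro b h1 h2 h3 h0
  have hd : (pole a).denom ∣ X - C a := by
    have : pole a = algebraMap ℂ[X] (RatFunc ℂ) 1 / algebraMap ℂ[X] (RatFunc ℂ) (X - C a) := by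
      rw [algebraMap_X_sub_C, map_one, pole, one_div]
    rw [this]
    exact RatFunc.denom_div_dvd _ _
  obtain ⟨q, hq⟩ := hd
  have := congrArg (Polynomial.eval b) hq
  rw [Polynomial.eval_mul, h0, zero_mul] at this
  have hba : b = a := by simpa [sub_eq_zero] using this
  subst hba
  rcases ha with h | h | h
  · exact h1 h
  · exact h2 h
  · exact h3 h

variable (N)

/-- The sum of the residues of `f dz / (z - a)`. -/
def evalRes (a : ℂ) : RatFunc ℂ →ₗ[ℂ] ℂ := (resSum N).comp (LinearMap.mulRight ℂ (pole a))

theorem evalRes_apply (a : ℂ) (f : RatFunc ℂ) : evalRes N a f = resSum N (f * pole a) := rfl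

/-- `p / (z - a)` is a polynomial plus `p(a) / (z - a)`. Residues thereby extend evaluation at `a`
to all cochains, with no choice of a polynomial representative. -/
theorem evalRes_algebraMap {a : ℂ} (ha : a = N.z₁ ∨ a = N.z₂ ∨ a = N.z₃) (p : ℂ[X]) :
    evalRes N a (algebraMap ℂ[X] (RatFunc ℂ) p) = p.eval a := by
  obtain ⟨q, hq⟩ := exists_mul_pole_eq p a
  rw [evalRes_apply, hq, map_add, resSum_algebraMap, map_smul, zero_add]
  have : resSum N (pole a) = 1 := by
    rcases ha with rfl | rfl | rfl
    · simpa [simplePoles] using resSum_simplePoles N (1, 0, 0)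
    · simpa [simplePoles] using resSum_simplePoles N (0, 1, 0)
    · simpa [simplePoles] using resSum_simplePoles N (0, 0, 1)
  rw [this, smul_eq_mul, mul_one]

/-- The difference is the residue sum of `f (1/(z - a) - 1/(z - b))`, which is `O(z⁻²)`. Functions
regular at infinity thus behave like constants. -/
theorem evalRes_eq_evalRes {a b : ℂ} (ha : a = N.z₁ ∨ a = N.z₂ ∨ a = N.z₃)
    (hb : b = N.z₁ ∨ b = N.z₂ ∨ b = N.z₃) {f : RatFunc ℂ} (hf : RegularOff N f)
    (hd : f ∈ degLE 0) : evalRes N a f = evalRes N b f := by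
  rw [← sub_eq_zero, evalRes_apply, evalRes_apply, ← map_sub, ← mul_sub]
  refine resSum_eq_zero ?_ (mul_mem_degLE (by norm_num) hd (pole_sub_pole_mem_degLE a b))
  refine hf.mul ?_
  rw [sub_eq_add_neg, ← neg_one_smul ℂ (pole b)]
  exact (regularOff_pole ha).add ((regularOff_pole hb).smul _)

end SumOfResidues

/-! ## The first cohomology group and Serre's pairing -/

section Cohomology

variable {n : ℕ} (N : MarkedNode)

theorem exists_eval_eq₃ (a b c : ℂ) :
    ∃ p : ℂ[X], p.eval N.z₁ = a ∧ p.eval N.z₂ = b ∧ p.eval N.z₃ = c := by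
  obtain ⟨p, h1, h2⟩ := exists_eval_eq N a b
  have h13 := sub_ne_zero.2 N.ne₁₃.symm
  have h23 := sub_ne_zero.2 N.ne₂₃.symm
  refine ⟨p + C ((c - p.eval N.z₃) / ((N.z₃ - N.z₁) * (N.z₃ - N.z₂))) *
    ((X - C N.z₁) * (X - C N.z₂)), by simp [h1], by simp [h2], ?_⟩
  simp
  field_simp
  ring

/-- Entrywise sum of the residues of `c dz / (z - a)`. -/
def evalResMat (n : ℕ) (a : ℂ) : RatMat n →ₗ[ℂ] Mat n := (evalRes N a).mapMatrix

theorem evalResMat_apply (a : ℂ) (c : RatMat n) (i j : Fin n) :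
    evalResMat N n a c i j = evalRes N a (c i j) := rfl

theorem evalResMat_toRat {a : ℂ} (ha : a = N.z₁ ∨ a = N.z₂ ∨ a = N.z₃) (χ : PolyMat n) :
    evalResMat N n a (toRat χ) = evalMat a χ := by
  ext i j
  exact evalRes_algebraMap N ha (χ i j)

theorem evalResMat_eq_of_mem_outerSections {a b : ℂ} (ha : a = N.z₁ ∨ a = N.z₂ ∨ a = N.z₃)
    (hb : b = N.z₁ ∨ b = N.z₂ ∨ b = N.z₃) {c : RatMat n} (hc : c ∈ outerSections N n) :
    evalResMat N n a c = evalResMat N n b c := by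
  ext i j
  exact evalRes_eq_evalRes N ha hb (hc i j).1 (hc i j).2

theorem resSum_trace_mul (a : ℂ) (A : Mat n) (c : RatMat n) :
    resSum N ((pole a • A.map RatFunc.C) * c).trace = (A * evalResMat N n a c).trace := by
  simp only [Matrix.trace, Matrix.diag, Matrix.mul_apply, map_sum]
  refine Finset.sum_congr rfl fun i _ => Finset.sum_congr rfl fun j _ => ?_
  have : (pole a • A.map RatFunc.C) i j * c j i = A i j • (c j i * pole a) := by
    rw [Matrix.smul_apply, Matrix.map_apply, RatFunc.smul_eq_C_mul, smul_eq_mul]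
    ring
  rw [this, map_smul, evalResMat_apply, evalRes_apply, smul_eq_mul]

theorem serrePairing_higgsField (Φ₁ Φ₂ Φ₃ : Mat n) (c : RatMat n) :
    serrePairing N (higgsField N Φ₁ Φ₂ Φ₃) c = (Φ₁ * evalResMat N n N.z₁ c).trace -
      (Φ₂ * evalResMat N n N.z₂ c).trace + (Φ₃ * evalResMat N n N.z₃ c).trace := by
  change resSum N (((pole N.z₁ • Φ₁.map RatFunc.C - pole N.z₂ • Φ₂.map RatFunc.C +
    pole N.z₃ • Φ₃.map RatFunc.C) * c).trace) = _
  rw [add_mul, sub_mul, trace_add, trace_sub, map_add, map_sub, resSum_trace_mul, resSum_trace_mul,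
    resSum_trace_mul]

/-- Left multiplication by `A` and right multiplication by `B`. -/
def sandwich (A B : Mat n) : Mat n →ₗ[ℂ] Mat n :=
  (LinearMap.mulRight ℂ B).comp (LinearMap.mulLeft ℂ A)

/-- The Kodaira–Spencer map on cochains. -/
def kodairaSpencer (m : Mat n × Mat n) : RatMat n →ₗ[ℂ] Mat n :=
  (sandwich m.2⁻¹ m.2).comp
    ((LinearMap.mulRight ℂ m.1).comp (evalResMat N n N.z₁) -
      (LinearMap.mulLeft ℂ m.1).comp (evalResMat N n N.z₂) +
      (LinearMap.mulLeft ℂ m.1 - LinearMap.mulRight ℂ m.1).comp (evalResMat N n N.z₃))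

theorem kodairaSpencer_apply (m : Mat n × Mat n) (c : RatMat n) :
    kodairaSpencer N m c = m.2⁻¹ * (evalResMat N n N.z₁ c * m.1 - m.1 * evalResMat N n N.z₂ c +
      (m.1 * evalResMat N n N.z₃ c - evalResMat N n N.z₃ c * m.1)) * m.2 := rfl

theorem kodairaSpencer_toRat (m : Mat n × Mat n) (χ : PolyMat n) :
    kodairaSpencer N m (toRat χ) = m.2⁻¹ * (evalMat N.z₁ χ * m.1 - m.1 * evalMat N.z₂ χ +
      (m.1 * evalMat N.z₃ χ - evalMat N.z₃ χ * m.1)) * m.2 := by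
  rw [kodairaSpencer_apply, evalResMat_toRat N (.inl rfl), evalResMat_toRat N (.inr (.inl rfl)),
    evalResMat_toRat N (.inr (.inr rfl))]

variable {m : Mat n × Mat n}

theorem kodairaSpencer_toRat_eq_fderiv (hm : IsUnit m.2.det) (χ : PolyMat n) :
    kodairaSpencer N m (toRat χ) = fderiv ℂ moduliMap m (deformation N m χ) := by
  rw [kodairaSpencer_toRat, (fderiv_moduliMap hm).2]
  have : evalMat N.z₃ χ * m.2 * m.2⁻¹ = evalMat N.z₃ χ := by
    rw [mul_assoc, Matrix.mul_nonsing_inv _ hm, mul_one]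
  simp only [deformation, this]

theorem toRat_add (χ ψ : PolyMat n) : toRat (χ + ψ) = toRat χ + toRat ψ := by
  ext1 i j; simp [toRat]

theorem toRat_sub (χ ψ : PolyMat n) : toRat (χ - ψ) = toRat χ - toRat ψ := by
  ext1 i j; simp [toRat]

theorem evalMat_sub (a : ℂ) (χ ψ : PolyMat n) :
    evalMat a (χ - ψ) = evalMat a χ - evalMat a ψ := by
  ext1 i j; simp [evalMat]

theorem toRat_constMat_mem_outerSections (A : Mat n) :
    toRat (constMat A) ∈ outerSections N n := by
  intro i j
  refine ⟨RegularOff.of_polynomial N _, .inr ?_⟩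
  rw [toRat, Matrix.map_apply, RatFunc.intDegree_polynomial, natDegree_constMat]
  rfl

/-- All three generalised values equal one matrix `k`, and `k Λ - Λ k + [Λ, k] = 0`. -/
theorem kodairaSpencer_of_mem_outerSections {c : RatMat n} (hc : c ∈ outerSections N n) :
    kodairaSpencer N m c = 0 := by
  rw [kodairaSpencer_apply,
    evalResMat_eq_of_mem_outerSections N (.inr (.inl rfl)) (.inl rfl) hc,
    evalResMat_eq_of_mem_outerSections N (.inr (.inr rfl)) (.inl rfl) hc]
  simp

theorem kodairaSpencer_of_mem_affineSections {c : RatMat n} (hc : c ∈ affineSections N m.1) :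
    kodairaSpencer N m c = 0 := by
  have : affineSections N m.1 ≤ LinearMap.ker (kodairaSpencer N m) := by
    refine Submodule.span_le.2 ?_
    rintro _ ⟨A, ⟨hA, h3⟩, rfl⟩
    rw [SetLike.mem_coe, LinearMap.mem_ker, kodairaSpencer_toRat, h3,
      (mem_endModule_iff N m.1 A).1 hA]
    simp
  exact this hc

/-- `χ` is the polynomial part of the partial fractions; the polar parts are regular at infinity. -/
theorem exists_toRat_add_outer {c : RatMat n} (hc : c ∈ cochains N n) :
    ∃ χ : PolyMat n, c - toRat χ ∈ outerSections N n := by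
  choose p r h hf hd hr using fun i j => exists_decomposition (hc i j)
  refine ⟨Matrix.of p, fun i j => ?_⟩
  constructor
  · have : (c - toRat (Matrix.of p)) i j =
        c i j + (-1 : ℂ) • algebraMap ℂ[X] (RatFunc ℂ) (p i j) := by
      simp [toRat, sub_eq_add_neg]
    rw [this]
    exact (hc i j).add ((RegularOff.of_polynomial N _).smul _)
  · have : (c - toRat (Matrix.of p)) i j = simplePoles N (r i j) + h i j := by
      rw [Matrix.sub_apply, hf i j, toRat, Matrix.map_apply, Matrix.of_apply]
      ring
    rw [this]
    exact add_mem (degLE_mono (by norm_num) (simplePoles_mem_degLE N (r i j)))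
      (degLE_mono (by norm_num) (hd i j) : h i j ∈ degLE 0)

/-- Modulo outer sections `c` is a polynomial matrix, and subtracting the constant `χ(z₃)`, itself
an outer section, makes it vanish at `p`. For such a matrix, the vanishing of the image is the
condition of preserving `M_Λ`. -/
theorem mem_sup_of_kodairaSpencer_eq_zero (hm : IsUnit m.2.det) {c : RatMat n}
    (hc : c ∈ cochains N n) (h : kodairaSpencer N m c = 0) :
    c ∈ affineSections N m.1 ⊔ outerSections N n := by
  obtain ⟨χ, hχ⟩ := exists_toRat_add_outer N hc
  set k := evalMat N.z₃ χ with hk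
  have h0 : kodairaSpencer N m (toRat (χ - constMat k)) = 0 := by
    have : toRat (χ - constMat k) = c - (c - toRat χ) - toRat (constMat k) := by
      rw [toRat_sub]; abel
    rw [this, map_sub, map_sub, h, kodairaSpencer_of_mem_outerSections N hχ,
      kodairaSpencer_of_mem_outerSections N (toRat_constMat_mem_outerSections N k)]
    simp
  have h3 : evalMat N.z₃ (χ - constMat k) = 0 := by
    rw [evalMat_sub, evalMat_constMat, hk, sub_self]
  have hend : χ - constMat k ∈ endModule N m.1 := by
    rw [mem_endModule_iff, ← sub_eq_zero]
    rw [kodairaSpencer_toRat, h3] at h0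
    have := congrArg (fun Z => m.2 * Z * m.2⁻¹) h0
    simpa only [mul_assoc, mul_inv_cancel_left' hm, Matrix.mul_nonsing_inv _ hm, mul_one, mul_zero,
      zero_mul, sub_zero, add_zero] using this
  have : c = toRat (χ - constMat k) + (toRat (constMat k) + (c - toRat χ)) := by
    rw [toRat_sub]; abel
  rw [this]
  exact Submodule.add_mem_sup (Submodule.subset_span ⟨_, ⟨hend, h3⟩, rfl⟩)
    (add_mem (toRat_constMat_mem_outerSections N k) hχ)

theorem ker_kodairaSpencer (hm : IsUnit m.2.det) :
    LinearMap.ker ((kodairaSpencer N m).comp (cochains N n).subtype) =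
      (affineSections N m.1 ⊔ outerSections N n).comap (cochains N n).subtype := by
  ext c
  rw [LinearMap.mem_ker, Submodule.mem_comap, LinearMap.comp_apply]
  constructor
  · exact mem_sup_of_kodairaSpencer_eq_zero N hm c.2
  · intro h
    obtain ⟨a, ha, b, hb, hab⟩ := Submodule.mem_sup.1 h
    rw [← hab, map_add, kodairaSpencer_of_mem_affineSections N ha,
      kodairaSpencer_of_mem_outerSections N hb, add_zero]

theorem kodairaSpencer_surjective (hΛ : IsUnit m.1.det) (hm : IsUnit m.2.det) :
    Function.Surjective ((kodairaSpencer N m).comp (cochains N n).subtype) := by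
  intro B
  -- With `χ` zero at `z₂` and `z₃`, only the term `χ(z₁) Λ` survives.
  obtain ⟨p, h1, h2, h3⟩ := exists_eval_eq₃ N 1 0 0
  refine ⟨polyCochain N (p • constMat (m.2 * B * m.2⁻¹ * m.1⁻¹)), ?_⟩
  change kodairaSpencer N m (toRat _) = B
  have he (a : ℂ) (A : Mat n) : evalMat a (p • constMat A) = p.eval a • A := by
    ext i j; simp [evalMat, constMat]
  rw [kodairaSpencer_toRat, he, he, he, h1, h2, h3]
  simp only [one_smul, zero_smul, zero_mul, mul_zero, sub_zero, add_zero, mul_assoc,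
    Matrix.nonsing_inv_mul _ hΛ, Matrix.nonsing_inv_mul _ hm, mul_one, inv_mul_cancel_left' hm]

/-- The Kodaira–Spencer isomorphism of `H¹(Σ, End(V) ⊗ 𝒪(-p))` with the tangent space of the
moduli space. -/
def kodairaSpencerEquiv (hΛ : IsUnit m.1.det) (hm : IsUnit m.2.det) : H1 N m.1 ≃ₗ[ℂ] Mat n :=
  (Submodule.quotEquivOfEq _ _ (ker_kodairaSpencer N hm).symm).trans
    (((kodairaSpencer N m).comp (cochains N n).subtype).quotKerEquivOfSurjective
      (kodairaSpencer_surjective N hΛ hm))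

/-- Write `A = Λ⁻¹ Φ₁` and `x₁`, `x₂`, `x₃` for the generalised values of `c`. By cyclicity `Tr A
(x₁ Λ - Λ x₂ + [Λ, x₃])` pairs them with `Λ A = Φ₁`, `-A Λ = -Φ₂` and `[A, Λ] = Φ₃`. -/
theorem trace_mul_kodairaSpencer {y : Quad n} (hy : y ∈ zeroLevel n) (c : RatMat n) :
    ((reductionMap y).2 * kodairaSpencer N (y.L, y.U) c).trace =
      serrePairing N (higgsField N y.Φ₁ y.Φ₂ y.Φ₃) c := by
  have hp := mem_phaseSpace_of_mem_zeroLevel hy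
  have h1 := Φ₁_eq hp
  have h2 : y.Φ₂ = y.L⁻¹ * y.Φ₁ * y.L := rfl
  rw [serrePairing_higgsField, kodairaSpencer_apply, reductionMap, trace_conj_mul_conj hp.2,
    Φ₃_eq_of_mem_zeroLevel hy, h2]
  generalize y.L⁻¹ * y.Φ₁ = A at *
  rw [h1]
  generalize evalResMat N n N.z₁ c = x₁
  generalize evalResMat N n N.z₂ c = x₂
  generalize evalResMat N n N.z₃ c = x₃
  have e1 := Matrix.trace_mul_comm (A * x₁) y.L
  have e3 := Matrix.trace_mul_comm (A * x₃) y.L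
  simp only [mul_add, mul_sub, sub_mul, mul_assoc, trace_add, trace_sub] at *
  linear_combination e1 - e3

end Cohomology

/-! ## Higgs fields -/

section Higgs

variable {n : ℕ} (N : MarkedNode)

theorem higgsField_apply (Φ₁ Φ₂ Φ₃ : Mat n) (i j : Fin n) :
    higgsField N Φ₁ Φ₂ Φ₃ i j = simplePoles N (Φ₁ i j, -Φ₂ i j, Φ₃ i j) := by
  simp only [higgsField, simplePoles, Matrix.add_apply, Matrix.sub_apply, Matrix.smul_apply,
    Matrix.map_apply, RatFunc.smul_eq_C_mul, smul_eq_mul, pole, map_neg]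
  ring

/-- A polynomial times a combination of simple poles. -/
theorem exists_mul_simplePoles (p : ℂ[X]) (c : ℂ × ℂ × ℂ) : ∃ q : ℂ[X],
    algebraMap ℂ[X] (RatFunc ℂ) p * simplePoles N c = algebraMap ℂ[X] (RatFunc ℂ) q +
      simplePoles N (c.1 * p.eval N.z₁, c.2.1 * p.eval N.z₂, c.2.2 * p.eval N.z₃) := by
  obtain ⟨q₁, h₁⟩ := exists_mul_pole_eq p N.z₁
  obtain ⟨q₂, h₂⟩ := exists_mul_pole_eq p N.z₂
  obtain ⟨q₃, h₃⟩ := exists_mul_pole_eq p N.z₃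
  refine ⟨C c.1 * q₁ + C c.2.1 * q₂ + C c.2.2 * q₃, ?_⟩
  simp only [simplePoles, mul_add, mul_smul_comm, h₁, h₂, h₃, smul_add, smul_smul]
  simp only [RatFunc.smul_eq_C_mul, map_add, map_mul, RatFunc.algebraMap_C]
  ring

variable {N}

/-- Sections of `𝒦 ⊗ 𝒪(p)` over the affine part have the expected principal parts. -/
theorem exists_of_mem_dualizingSections {w : RatFunc ℂ} (hw : w ∈ dualizingSections N) :
    ∃ (q : ℂ[X]) (r c : ℂ),
      w = algebraMap ℂ[X] (RatFunc ℂ) q + simplePoles N (r, -r, c) := by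
  obtain ⟨⟨q, hq⟩, hr⟩ := hw
  have hw : w = algebraMap ℂ[X] (RatFunc ℂ) q * (pole N.z₁ * pole N.z₂ * pole N.z₃) := by
    rw [← hq]
    simp only [map_mul, algebraMap_X_sub_C]
    calc w = w * ((RatFunc.X - RatFunc.C N.z₁) * pole N.z₁) *
        ((RatFunc.X - RatFunc.C N.z₂) * pole N.z₂) *
        ((RatFunc.X - RatFunc.C N.z₃) * pole N.z₃) := by simp only [X_sub_C_mul_pole, mul_one]
      _ = _ := by ring
  have hp : ∃ c, pole N.z₁ * pole N.z₂ * pole N.z₃ = simplePoles N c := by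
    refine ⟨((N.z₁ - N.z₂)⁻¹ * (N.z₁ - N.z₃)⁻¹, -((N.z₁ - N.z₂)⁻¹ * (N.z₂ - N.z₃)⁻¹),
      (N.z₁ - N.z₂)⁻¹ * (N.z₂ - N.z₃)⁻¹ - (N.z₁ - N.z₂)⁻¹ * (N.z₁ - N.z₃)⁻¹), ?_⟩
    rw [pole_mul_pole N.ne₁₂, smul_mul_assoc, sub_mul, pole_mul_pole N.ne₁₃, pole_mul_pole N.ne₂₃]
    simp only [simplePoles, RatFunc.smul_eq_C_mul, map_mul, map_neg, map_sub]
    ring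
  obtain ⟨c, hc⟩ := hp
  obtain ⟨q', hq'⟩ := exists_mul_simplePoles N q c
  rw [hc, hq'] at hw
  refine ⟨q', c.1 * q.eval N.z₁, c.2.2 * q.eval N.z₃, hw.trans ?_⟩
  congr 2
  refine Prod.ext rfl (Prod.ext ?_ rfl)
  have hr' : residueLin N.z₁ w + residueLin N.z₂ w = 0 := hr
  rw [hw, map_add, map_add, residueLin_algebraMap, residueLin_algebraMap,
    (residueLin_simplePoles N _).1, (residueLin_simplePoles N _).2.1] at hr'
  simp only [zero_add] at hr'
  linear_combination hr'

theorem simplePoles_mem_dualizingSections (r c : ℂ) :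
    simplePoles N (r, -r, c) ∈ dualizingSections N := by
  refine ⟨⟨C r * ((X - C N.z₂) * (X - C N.z₃)) - C r * ((X - C N.z₁) * (X - C N.z₃)) +
    C c * ((X - C N.z₁) * (X - C N.z₂)), ?_⟩, ?_⟩
  · simp only [map_add, map_sub, map_mul, RatFunc.algebraMap_X, RatFunc.algebraMap_C, simplePoles,
      RatFunc.smul_eq_C_mul, map_neg]
    linear_combination
      (RatFunc.C r * (RatFunc.X - RatFunc.C N.z₂) * (RatFunc.X - RatFunc.C N.z₃)) *
          X_sub_C_mul_pole N.z₁
        - (RatFunc.C r * (RatFunc.X - RatFunc.C N.z₁) * (RatFunc.X - RatFunc.C N.z₃)) *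
          X_sub_C_mul_pole N.z₂
        + (RatFunc.C c * (RatFunc.X - RatFunc.C N.z₁) * (RatFunc.X - RatFunc.C N.z₂)) *
          X_sub_C_mul_pole N.z₃
  · change residueLin N.z₁ _ + residueLin N.z₂ _ = 0
    rw [(residueLin_simplePoles N _).1, (residueLin_simplePoles N _).2.1]
    simp

/-- Sections over the affine part of `End(V) ⊗ 𝒦 ⊗ 𝒪(p)`. -/
theorem exists_smul_toRat (q : ℂ[X]) (r c : ℂ) (A : PolyMat n) : ∃ R : PolyMat n,
    (algebraMap ℂ[X] (RatFunc ℂ) q + simplePoles N (r, -r, c)) • toRat A =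
      toRat R + higgsField N (r • evalMat N.z₁ A) (r • evalMat N.z₂ A) (c • evalMat N.z₃ A) := by
  choose R hR using fun i j => exists_mul_simplePoles N (A i j) (r, -r, c)
  refine ⟨Matrix.of fun i j => q * A i j + R i j, ?_⟩
  ext1 i j
  rw [Matrix.smul_apply, Matrix.add_apply, higgsField_apply, smul_eq_mul, add_mul,
    mul_comm (simplePoles N _)]
  change _ + algebraMap ℂ[X] (RatFunc ℂ) (A i j) * _ =
    algebraMap ℂ[X] (RatFunc ℂ) (q * A i j + R i j) + _
  rw [hR, map_add, map_mul, add_assoc]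
  simp only [evalMat, toRat, Matrix.map_apply, Matrix.smul_apply, smul_eq_mul, neg_mul]

/-- The product of an endomorphism and a differential with opposite residues `r`, `-r` has principal
parts `r A(z₁)`, `-r A(z₂)`, which `Λ` intertwines. This condition is linear, so it passes to sums.
-/
theorem exists_of_mem_span {Λ : Mat n} {Φ : RatMat n}
    (h : Φ ∈ Submodule.span ℂ {B : RatMat n | ∃ A ∈ endModule N Λ, ∃ w ∈ dualizingSections N,
      B = w • toRat A}) : ∃ (R : PolyMat n) (Φ₁ Φ₂ Φ₃ : Mat n), Φ₁ * Λ = Λ * Φ₂ ∧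
      Φ = toRat R + higgsField N Φ₁ Φ₂ Φ₃ := by
  induction h using Submodule.span_induction with
  | mem B hB =>
    obtain ⟨A, hA, w, hw, rfl⟩ := hB
    obtain ⟨q, r, c, rfl⟩ := exists_of_mem_dualizingSections hw
    obtain ⟨R, hR⟩ := exists_smul_toRat (N := N) q r c A
    refine ⟨R, _, _, _, ?_, hR⟩
    rw [smul_mul_assoc, (mem_endModule_iff N Λ A).1 hA, mul_smul_comm]
  | zero =>
    refine ⟨0, 0, 0, 0, by simp, ?_⟩
    ext1 i j
    simp [higgsField_apply, simplePoles, toRat]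
  | add B B' _ _ hB hB' =>
    obtain ⟨R, Φ₁, Φ₂, Φ₃, h, rfl⟩ := hB
    obtain ⟨R', Φ₁', Φ₂', Φ₃', h', rfl⟩ := hB'
    refine ⟨R + R', Φ₁ + Φ₁', Φ₂ + Φ₂', Φ₃ + Φ₃', by rw [add_mul, h, h', mul_add], ?_⟩
    ext1 i j
    simp only [toRat_add, Matrix.add_apply, higgsField_apply]
    rw [add_add_add_comm, ← simplePoles_add]
    congr 2
    refine Prod.ext rfl (Prod.ext ?_ rfl)
    simp [add_comm]
  | smul t B _ hB =>
    obtain ⟨R, Φ₁, Φ₂, Φ₃, h, rfl⟩ := hB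
    refine ⟨C t • R, t • Φ₁, t • Φ₂, t • Φ₃, by rw [smul_mul_assoc, h, mul_smul_comm], ?_⟩
    ext1 i j
    rw [Matrix.smul_apply, Matrix.add_apply, Matrix.add_apply, higgsField_apply, higgsField_apply,
      smul_add, ← simplePoles_smul]
    congr 1
    · simp [toRat, RatFunc.smul_eq_C_mul]
    · congr 1
      refine Prod.ext rfl (Prod.ext ?_ rfl)
      simp

/-- A multiple of `(z - z₁)(z - z₂)` vanishes at both preimages of the node, hence preserves `M_Λ`
for any `B`; the differential `1/(z - z₁) - 1/(z - z₂) = (z₁ - z₂)/((z - z₁)(z - z₂))` cancels that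
factor. -/
theorem toRat_mem_span (Λ : Mat n) (B : PolyMat n) :
    toRat B ∈ Submodule.span ℂ {B : RatMat n | ∃ A ∈ endModule N Λ, ∃ w ∈ dualizingSections N,
      B = w • toRat A} := by
  have h := sub_ne_zero.2 N.ne₁₂
  refine Submodule.subset_span ⟨(C (N.z₁ - N.z₂)⁻¹ * ((X - C N.z₁) * (X - C N.z₂))) • B, ?_,
    simplePoles N (1, -1, 0), simplePoles_mem_dualizingSections 1 0, ?_⟩
  · rw [mem_endModule_iff]
    have h1 : evalMat N.z₁ ((C (N.z₁ - N.z₂)⁻¹ * ((X - C N.z₁) * (X - C N.z₂))) • B) = 0 := by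
      ext1 i j; simp [evalMat]
    have h2 : evalMat N.z₂ ((C (N.z₁ - N.z₂)⁻¹ * ((X - C N.z₁) * (X - C N.z₂))) • B) = 0 := by
      ext1 i j; simp [evalMat]
    rw [h1, h2, zero_mul, mul_zero]
  · ext1 i j
    have hc : (RatFunc.C (N.z₁ - N.z₂)⁻¹ : RatFunc ℂ) * (RatFunc.C N.z₁ - RatFunc.C N.z₂) = 1 := by
      rw [← map_sub, ← map_mul, inv_mul_cancel₀ h, map_one]
    simp only [toRat, Matrix.smul_apply, Matrix.map_apply, smul_eq_mul, map_mul,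
      algebraMap_X_sub_C, RatFunc.algebraMap_C, simplePoles, RatFunc.smul_eq_C_mul, map_neg,
      map_one, map_zero]
    have e1 := X_sub_C_mul_pole N.z₁
    have e2 := X_sub_C_mul_pole N.z₂
    generalize algebraMap ℂ[X] (RatFunc ℂ) (B i j) = b
    generalize (RatFunc.C (N.z₁ - N.z₂)⁻¹ : RatFunc ℂ) = k at *
    linear_combination -b * hc - b * k * (RatFunc.X - RatFunc.C N.z₂) * e1 +
      b * k * (RatFunc.X - RatFunc.C N.z₁) * e2

theorem exists_evalMat_eq (N : MarkedNode) (A B D : Mat n) : ∃ χ : PolyMat n,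
    evalMat N.z₁ χ = A ∧ evalMat N.z₂ χ = B ∧ evalMat N.z₃ χ = D := by
  choose p h1 h2 h3 using fun i j => exists_eval_eq₃ N (A i j) (B i j) (D i j)
  exact ⟨Matrix.of p, Matrix.ext h1, Matrix.ext h2, Matrix.ext h3⟩

/-- Two products realise the principal parts, one for the node and one for `p`; the polynomial error
is absorbed by `toRat_mem_span`. -/
theorem higgsField_mem_span {Λ Φ₁ Φ₂ : Mat n} (h : Φ₁ * Λ = Λ * Φ₂) (Φ₃ : Mat n) :
    higgsField N Φ₁ Φ₂ Φ₃ ∈ Submodule.span ℂ {B : RatMat n | ∃ A ∈ endModule N Λ,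
      ∃ w ∈ dualizingSections N, B = w • toRat A} := by
  obtain ⟨A, h1, h2, h3⟩ := exists_evalMat_eq N Φ₁ Φ₂ 0
  obtain ⟨A', h1', h2', h3'⟩ := exists_evalMat_eq N 0 0 Φ₃
  obtain ⟨R, hR⟩ := exists_smul_toRat (N := N) 0 1 0 A
  obtain ⟨R', hR'⟩ := exists_smul_toRat (N := N) 0 0 1 A'
  rw [map_zero, zero_add] at hR hR'
  have hs : higgsField N Φ₁ Φ₂ Φ₃ = simplePoles N (1, -1, 0) • toRat A +
      simplePoles N (0, -0, 1) • toRat A' - toRat (R + R') := by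
    rw [hR, hR', h1, h2, h3', toRat_add]
    ext1 i j
    have : simplePoles N (Φ₁ i j, -Φ₂ i j, Φ₃ i j) =
        simplePoles N (Φ₁ i j, -Φ₂ i j, 0) + simplePoles N (0, 0, Φ₃ i j) := by
      rw [← simplePoles_add]
      simp
    simp only [Matrix.sub_apply, Matrix.add_apply, higgsField_apply, this, one_smul,
      zero_smul, Matrix.zero_apply, neg_zero]
    ring
  rw [hs]
  refine sub_mem (add_mem ?_ ?_) (toRat_mem_span Λ _)
  · exact Submodule.subset_span ⟨A, by rw [mem_endModule_iff, h1, h2, h], _,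
      simplePoles_mem_dualizingSections 1 0, rfl⟩
  · exact Submodule.subset_span ⟨A', by rw [mem_endModule_iff, h1', h2', zero_mul, mul_zero], _,
      simplePoles_mem_dualizingSections 0 1, rfl⟩

/-- The global sections of `End(V)* ⊗ 𝒦 ⊗ 𝒪(p)`. -/
theorem mem_higgsFields_iff (Λ : Mat n) (Φ : RatMat n) : Φ ∈ higgsFields N Λ ↔
    ∃ Φ₁ Φ₂ Φ₃ : Mat n, Φ₁ * Λ = Λ * Φ₂ ∧ Φ₁ - Φ₂ + Φ₃ = 0 ∧ Φ = higgsField N Φ₁ Φ₂ Φ₃ := by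
  constructor
  · rintro ⟨hs, hd⟩
    obtain ⟨R, Φ₁, Φ₂, Φ₃, h, rfl⟩ := exists_of_mem_span hs
    have key (i j : Fin n) : R i j = 0 ∧ Φ₁ i j + -Φ₂ i j + Φ₃ i j = 0 := by
      have := hd i j
      rw [Matrix.add_apply, higgsField_apply] at this
      exact eq_zero_of_mem_degLE N (p := R i j) (c := (Φ₁ i j, -Φ₂ i j, Φ₃ i j)) this
    refine ⟨Φ₁, Φ₂, Φ₃, h, ?_, ?_⟩
    · ext i j
      simpa [sub_eq_add_neg] using (key i j).2
    · ext1 i j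
      simp [toRat, (key i j).1]
  · rintro ⟨Φ₁, Φ₂, Φ₃, h, h0, rfl⟩
    refine ⟨higgsField_mem_span h Φ₃, fun i j => ?_⟩
    rw [higgsField_apply]
    refine simplePoles_mem_degLE_of_sum N ?_
    simpa [sub_eq_add_neg] using congrFun (congrFun h0 i) j

end Higgs

/-! ## Diagonal matrices in the principal cell -/

section Diagonal

variable {n : ℕ}

theorem diagonal_mem_principalCell_iff {d : Fin n → ℂ} (hd : ∀ i, d i ≠ 0) :
    Matrix.diagonal d ∈ principalCell n ↔ Function.Injective d := by
  have h1 : IsUnit (Matrix.diagonal d).det := by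
    rw [det_diagonal, isUnit_iff_ne_zero]
    exact Finset.prod_ne_zero_iff.2 fun i _ => hd i
  have h2 : (Matrix.diagonal d).charpoly.roots = Finset.univ.val.map d := by
    rw [Matrix.charpoly_diagonal]
    exact Polynomial.roots_multiset_prod_X_sub_C (Finset.univ.val.map d) ▸ by
      rw [Multiset.map_map]; rfl
  rw [principalCell, Set.mem_ofPred_eq, h2]
  simp only [h1, true_and]
  exact ⟨fun h i j hij => Multiset.inj_on_of_nodup_map h i (Finset.mem_univ i) j
    (Finset.mem_univ j) hij, fun h => Finset.univ.nodup.map h⟩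

theorem inv_diagonal' {d : Fin n → ℂ} (hd : ∀ i, d i ≠ 0) :
    (Matrix.diagonal d)⁻¹ = Matrix.diagonal fun i => (d i)⁻¹ := by
  refine Matrix.inv_eq_right_inv ?_
  rw [Matrix.diagonal_mul_diagonal, ← Matrix.diagonal_one]
  congr 1
  funext i
  exact mul_inv_cancel₀ (hd i)

/-- A matrix with distinct eigenvalues is diagonalizable. -/
theorem exists_diagonalization {Λ : Mat n} (hΛ : Λ ∈ principalCell n) :
    ∃ P : Mat n, IsUnit P.det ∧ ∃ d : Fin n → ℂ, (∀ i, d i ≠ 0) ∧ Λ * P = P * Matrix.diagonal d := by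
  have hcard : Fintype.card Λ.charpoly.roots.toFinset = n := by
    rw [Fintype.card_coe, Multiset.toFinset_card_of_nodup hΛ.2,
      ← (IsAlgClosed.splits Λ.charpoly).natDegree_eq_card_roots, Matrix.charpoly_natDegree_eq_dim,
      Fintype.card_fin]
  let e : Fin n ≃ Λ.charpoly.roots.toFinset := (Fintype.equivFinOfCardEq hcard).symm
  let d : Fin n → ℂ := fun i => e i
  have hinj : Function.Injective d := Subtype.val_injective.comp e.injective
  have hex (i : Fin n) : ∃ v : Fin n → ℂ, v ≠ 0 ∧ Λ *ᵥ v = d i • v := by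
    have hr : Λ.charpoly.eval (d i) = 0 :=
      Polynomial.isRoot_of_mem_roots (Multiset.mem_toFinset.1 (e i).2)
    rw [Matrix.eval_charpoly] at hr
    obtain ⟨v, hv, h⟩ := Matrix.exists_mulVec_eq_zero_iff.2 hr
    refine ⟨v, hv, ?_⟩
    rw [Matrix.sub_mulVec, sub_eq_zero] at h
    rw [← h]
    simp [Matrix.scalar_apply]
  choose v hv hΛv using hex
  have hli : LinearIndependent ℂ v := by
    refine Module.End.eigenvectors_linearIndependent' (Matrix.toLin' Λ) d hinj v fun i => ?_
    exact ⟨Module.End.mem_eigenspace_iff.2 (by rw [Matrix.toLin'_apply, hΛv]), hv i⟩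
  let P : Mat n := Matrix.of fun i j => v j i
  have hP : IsUnit P := Matrix.linearIndependent_cols_iff_isUnit.1 hli
  refine ⟨P, (Matrix.isUnit_iff_isUnit_det _).1 hP, d, fun i h0 => hv i ?_, ?_⟩
  · have h := hΛv i
    rw [h0, zero_smul] at h
    rw [← Matrix.one_mulVec (v i), ← Matrix.nonsing_inv_mul _ hΛ.1, ← Matrix.mulVec_mulVec, h,
      Matrix.mulVec_zero]
  · ext i j
    rw [Matrix.mul_diagonal]
    have := congrFun (hΛv j) i
    rw [Pi.smul_apply, smul_eq_mul, mul_comm] at this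
    exact this

/-! ## Monomial matrices -/

/-- The monomial matrix with entries `t i` in the positions `(i, σ i)`. -/
def monomialMatrix (t : Fin n → ℂˣ) (σ : Equiv.Perm (Fin n)) : Mat n :=
  Matrix.of fun i j => if j = σ i then (t i : ℂ) else 0

variable (t : Fin n → ℂˣ) (σ : Equiv.Perm (Fin n))

theorem monomialMatrix_mul_apply (M : Mat n) (i j : Fin n) :
    (monomialMatrix t σ * M) i j = t i * M (σ i) j := by
  simp [Matrix.mul_apply, monomialMatrix]

theorem mul_monomialMatrix_apply (M : Mat n) (i j : Fin n) :
    (M * monomialMatrix t σ) i (σ j) = M i j * t j := by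
  simp [Matrix.mul_apply, monomialMatrix]

theorem monomialMatrix_mul_eq_iff (M M' : Mat n) :
    monomialMatrix t σ * M = M' * monomialMatrix t σ ↔
      ∀ i j, M' i j = t i * M (σ i) (σ j) * ((t j)⁻¹ : ℂˣ) := by
  constructor
  · intro h i j
    have := congrFun (congrFun h i) (σ j)
    rw [monomialMatrix_mul_apply, mul_monomialMatrix_apply] at this
    rw [this, Units.mul_inv_cancel_right]
  · intro h
    ext i k
    obtain ⟨j, rfl⟩ := σ.surjective k
    rw [monomialMatrix_mul_apply, mul_monomialMatrix_apply, h, Units.inv_mul_cancel_right]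

theorem isUnit_det_monomialMatrix : IsUnit (monomialMatrix t σ).det := by
  have : monomialMatrix t σ * (Matrix.of fun i j => if i = σ j then ((t j)⁻¹ : ℂ) else 0) = 1 := by
    ext i j
    rw [monomialMatrix_mul_apply, Matrix.of_apply, Matrix.one_apply]
    by_cases h : i = j
    · simp [h]
    · simp [h]
  rw [isUnit_iff_ne_zero]
  intro h0
  have hd := congrArg Matrix.det this
  rw [det_mul, h0, zero_mul, det_one] at hd
  exact zero_ne_one hd

/-- A matrix that intertwines two diagonal matrices with distinct entries is monomial. -/
theorem exists_eq_monomialMatrix {g : Mat n} (hg : IsUnit g.det) {d d' : Fin n → ℂ}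
    (hd : Function.Injective d) (hd' : Function.Injective d')
    (h : g * Matrix.diagonal d = Matrix.diagonal d' * g) :
    ∃ (t : Fin n → ℂˣ) (σ : Equiv.Perm (Fin n)), g = monomialMatrix t σ ∧ ∀ i, d' i = d (σ i) := by
  -- Entrywise the intertwining says `g i j * d j = d' i * g i j`; since `d` is injective, each row
  -- has at most one nonzero entry.
  have hz (i j : Fin n) (hij : g i j ≠ 0) : d' i = d j := by
    have := congrFun (congrFun h i) j
    rw [Matrix.mul_diagonal, Matrix.diagonal_mul, mul_comm] at this
    exact (mul_right_cancel₀ hij this).symm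
  have hrow (i : Fin n) : ∃ j, g i j ≠ 0 := by
    by_contra hn
    push Not at hn
    rw [Matrix.det_eq_zero_of_row_eq_zero i hn] at hg
    exact not_isUnit_zero hg
  choose s hs using hrow
  have hinj : Function.Injective s := fun i j hij => hd' (by
    rw [hz i (s i) (hs i), hz j (s j) (hs j), hij])
  refine ⟨fun i => Units.mk0 (g i (s i)) (hs i), Equiv.ofBijective s
    (Finite.injective_iff_bijective.1 hinj), ?_, fun i => hz i (s i) (hs i)⟩
  ext i j
  rw [monomialMatrix, Matrix.of_apply, Equiv.ofBijective_apply]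
  split_ifs with hj
  · rw [hj]; rfl
  · by_contra hne
    exact hj (hd ((hz i j hne).symm.trans (hz i (s i) (hs i))))

end Diagonal

/-! ## Calogero–Moser coordinates -/

section CalogeroMoser

variable {n : ℕ}

theorem exp_two_ratio (x y : ℂ) :
    Complex.exp (2 * y - 2 * x) = Complex.exp (2 * y) / Complex.exp (2 * x) := Complex.exp_sub _ _

theorem exp_ratio_ne_one {x : Fin n → ℂ} (hx : Function.Injective fun i => Complex.exp (2 * x i))
    {i j : Fin n} (hij : i ≠ j) : Complex.exp (2 * x j - 2 * x i) - 1 ≠ 0 := by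
  rw [exp_two_ratio, sub_ne_zero, ne_eq, div_eq_one_iff_eq (Complex.exp_ne_zero _)]
  exact fun h => hij (hx h.symm)

theorem diagonal_exp_inv (x : Fin n → ℂ) :
    (Matrix.diagonal fun i => Complex.exp (2 * x i))⁻¹ =
      Matrix.diagonal fun i => (Complex.exp (2 * x i))⁻¹ :=
  inv_diagonal' fun _ => Complex.exp_ne_zero _

theorem diagonal_exp_mem_iff (x : Fin n → ℂ) :
    (Matrix.diagonal fun i => Complex.exp (2 * x i)) ∈ principalCell n ↔
      Function.Injective fun i => Complex.exp (2 * x i) :=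
  diagonal_mem_principalCell_iff fun _ => Complex.exp_ne_zero _

theorem conj_diagonal_exp_apply (x : Fin n → ℂ) (M : Mat n) (i j : Fin n) :
    ((Matrix.diagonal fun i => Complex.exp (2 * x i))⁻¹ * M *
      Matrix.diagonal fun i => Complex.exp (2 * x i)) i j =
      Complex.exp (2 * x j - 2 * x i) * M i j := by
  rw [diagonal_exp_inv, Matrix.mul_diagonal, Matrix.diagonal_mul, exp_two_ratio]
  ring

/-- The moment map equation at a point with diagonal `Λ`, entrywise. -/
theorem conjMoment_eq_zero_iff {y : Quad n} {x : Fin n → ℂ}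
    (hx : Function.Injective fun i => Complex.exp (2 * x i))
    (hL : y.L = Matrix.diagonal fun i => Complex.exp (2 * x i)) :
    conjMoment y = 0 ↔ (∀ i, y.Φ₃ i i = 0) ∧
      ∀ i j, i ≠ j → y.Φ₁ i j = y.Φ₃ i j / (Complex.exp (2 * x j - 2 * x i) - 1) := by
  have he (i j : Fin n) : conjMoment y i j =
      y.Φ₁ i j - Complex.exp (2 * x j - 2 * x i) * y.Φ₁ i j + y.Φ₃ i j := by
    rw [conjMoment_eq, hL, Matrix.add_apply, Matrix.sub_apply, conj_diagonal_exp_apply]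
  have hd (i j : Fin n) (hij : i ≠ j) : conjMoment y i j = 0 ↔
      y.Φ₁ i j = y.Φ₃ i j / (Complex.exp (2 * x j - 2 * x i) - 1) := by
    rw [he, eq_div_iff (exp_ratio_ne_one hx hij)]
    constructor <;> intro h <;> linear_combination -h
  have hdiag (i : Fin n) : conjMoment y i i = y.Φ₃ i i := by
    rw [he, sub_self, Complex.exp_zero]
    ring
  constructor
  · intro h
    exact ⟨fun i => by rw [← hdiag, h]; rfl, fun i j hij => (hd i j hij).1 (by rw [h]; rfl)⟩
  · rintro ⟨h1, h2⟩
    ext i j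
    rcases eq_or_ne i j with rfl | hij
    · rw [hdiag, h1]; rfl
    · rw [(hd i j hij).2 (h2 i j hij)]; rfl

theorem cmPoint_Φ₁_diag (ν : Mat n) (c : CMCoord n) (i : Fin n) :
    (cmPoint ν c).Φ₁ i i = c.2.1 i := by
  simp [Quad.Φ₁, cmPoint]

theorem cmPoint_Φ₁_off (ν : Mat n) (c : CMCoord n) {i j : Fin n} (hij : i ≠ j) :
    (cmPoint ν c).Φ₁ i j = spin ν c i j / (Complex.exp (2 * c.1 j - 2 * c.1 i) - 1) := by
  simp [Quad.Φ₁, cmPoint, hij]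

theorem cmPoint_mem_zeroLevel {ν : Mat n} {c : CMCoord n} (hc : c ∈ cmLevel ν) :
    cmPoint ν c ∈ zeroLevel n :=
  ⟨⟨(diagonal_exp_mem_iff _).2 hc.1.1, hc.1.2⟩,
    (conjMoment_eq_zero_iff hc.1.1 rfl).2 ⟨hc.2, fun _ _ hij => cmPoint_Φ₁_off ν c hij⟩⟩

theorem frameMoment_cmPoint {ν : Mat n} {c : CMCoord n} (hc : IsUnit c.2.2.det) :
    frameMoment (cmPoint ν c) = ν := by
  change c.2.2⁻¹ * (c.2.2 * ν * c.2.2⁻¹) * c.2.2 = ν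
  simp only [mul_assoc, inv_mul_cancel_left' hc, Matrix.nonsing_inv_mul _ hc, mul_one]

theorem conjAct_mem_zeroLevel {y : Quad n} (hy : y ∈ zeroLevel n) (g : GL (Fin n) ℂ) :
    conjAct g y ∈ zeroLevel n := by
  have hg := isUnit_det_coe g
  have hi : ((g⁻¹ : GL (Fin n) ℂ) : Mat n) = (g : Mat n)⁻¹ := Matrix.coe_units_inv g
  refine ⟨⟨?_, ?_⟩, ?_⟩
  · change (g : Mat n) * y.L * ((g⁻¹ : GL (Fin n) ℂ) : Mat n) ∈ _
    rw [hi]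
    exact conj_mem_principalCell hg hy.1.1
  · exact (conjAct_mem_phaseSpace (mem_phaseSpace_of_mem_zeroLevel hy) g).2
  · have : conjMoment (conjAct g y) = (g : Mat n) * conjMoment y * (g : Mat n)⁻¹ := by
      simp only [conjMoment_eq]
      change (g : Mat n) * y.Φ₁ * ((g⁻¹ : GL (Fin n) ℂ) : Mat n) -
        ((g : Mat n) * y.L * ((g⁻¹ : GL (Fin n) ℂ) : Mat n))⁻¹ *
          ((g : Mat n) * y.Φ₁ * ((g⁻¹ : GL (Fin n) ℂ) : Mat n)) *
          ((g : Mat n) * y.L * ((g⁻¹ : GL (Fin n) ℂ) : Mat n)) +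
        (g : Mat n) * y.Φ₃ * ((g⁻¹ : GL (Fin n) ℂ) : Mat n) = _
      simp only [hi, Matrix.mul_inv_rev, Matrix.nonsing_inv_nonsing_inv _ hg, mul_assoc, mul_sub,
        mul_add, sub_mul, add_mul, inv_mul_cancel_left' hg]
    rw [this, hy.2, mul_zero, zero_mul]

/-- The inverse of an eigenvector matrix conjugates `Λ` to diagonal form; the constraint then fixes
the off-diagonal part of `Φ₁`, and `ν = U⁻¹ Φ₃ U` makes the spin matrix equal to `Φ₃`. -/
theorem exists_conjAct_eq_cmPoint {ν : Mat n} {y : Quad n} (hy : y ∈ zeroLevel n)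
    (hν : frameMoment y = ν) :
    ∃ g : GL (Fin n) ℂ, ∃ c ∈ cmLevel ν, conjAct g y = cmPoint ν c := by
  obtain ⟨P, hP, d, hd0, hd⟩ := exists_diagonalization hy.1.1
  obtain ⟨u, hu⟩ := (Matrix.isUnit_iff_isUnit_det _).2 hP
  have hui : ((u⁻¹ : GL (Fin n) ℂ) : Mat n) = P⁻¹ := by rw [Matrix.coe_units_inv, hu]
  have hlog (i : Fin n) : ∃ x, Complex.exp x = d i := ⟨_, Complex.exp_log (hd0 i)⟩
  choose x hx using hlog
  set z := conjAct u⁻¹ y with hz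
  have hz0 : z ∈ zeroLevel n := conjAct_mem_zeroLevel hy _
  -- The position is half a logarithm of the eigenvalue.
  have hexp (i : Fin n) : Complex.exp (2 * (x i / 2)) = d i := by
    rw [mul_div_cancel₀ _ two_ne_zero, hx]
  have hL : z.L = Matrix.diagonal fun i => Complex.exp (2 * (x i / 2)) := by
    simp only [hexp]
    change ((u⁻¹ : GL (Fin n) ℂ) : Mat n) * y.L * ((u⁻¹⁻¹ : GL (Fin n) ℂ) : Mat n) = _
    rw [hui, inv_inv, hu, mul_assoc, hd, inv_mul_cancel_left' hP]
  have hinj : Function.Injective fun i => Complex.exp (2 * (x i / 2)) := by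
    rw [← diagonal_exp_mem_iff (fun i => x i / 2), ← hL]
    exact hz0.1.1
  have hlev := (conjMoment_eq_zero_iff (x := fun i => x i / 2) hinj hL).1 hz0.2
  let c : CMCoord n := (fun i => x i / 2, fun i => z.Φ₁ i i, z.U)
  have hU : IsUnit z.U.det := hz0.1.2
  have hs : spin ν c = z.Φ₃ := by
    have hUy : IsUnit y.U.det := hy.1.2
    change z.U * ν * z.U⁻¹ = z.Φ₃
    rw [← hν, frameMoment]
    change ((u⁻¹ : GL (Fin n) ℂ) : Mat n) * y.U * (y.U⁻¹ * y.Φ₃ * y.U) *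
      (((u⁻¹ : GL (Fin n) ℂ) : Mat n) * y.U)⁻¹ =
      ((u⁻¹ : GL (Fin n) ℂ) : Mat n) * y.Φ₃ * ((u⁻¹⁻¹ : GL (Fin n) ℂ) : Mat n)
    rw [hui, inv_inv, hu, Matrix.mul_inv_rev, Matrix.nonsing_inv_nonsing_inv _ hP]
    simp only [mul_assoc, mul_inv_cancel_left' hUy]
  refine ⟨u⁻¹, c, ⟨⟨hinj, hU⟩, fun i => by rw [hs]; exact hlev.1 i⟩, ?_⟩
  refine Prod.ext hL (Prod.ext rfl (Prod.ext ?_ hs.symm))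
  change z.Φ₁ = (cmPoint ν c).Φ₁
  ext i j
  rcases eq_or_ne i j with rfl | hij
  · rw [cmPoint_Φ₁_diag]
  · rw [cmPoint_Φ₁_off ν c hij, hs]
    exact hlev.2 i j hij

/-- The framing action leaves `Λ`, `Φ₁`, `Φ₃` alone, so `g` intertwines two diagonal matrices with
distinct entries and is monomial; its permutation and scalars are `σ` and `t`. Positions enter only
through their exponentials because the logarithm is not unique. -/
theorem cmPoint_equivalent_iff {ν : Mat n} {c c' : CMCoord n} (hc : c ∈ cmLevel ν)
    (hc' : c' ∈ cmLevel ν) :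
    (∃ g h : GL (Fin n) ℂ, (h : Mat n) * ν = ν * (h : Mat n) ∧
        cmPoint ν c' = frameAct h (conjAct g (cmPoint ν c))) ↔
      ∃ σ : Equiv.Perm (Fin n), ∃ t : Fin n → ℂˣ,
        (∀ i, Complex.exp (2 * c'.1 i) = Complex.exp (2 * c.1 (σ i)) ∧
          c'.2.1 i = c.2.1 (σ i)) ∧
        ∀ i j, spin ν c' i j = (t i : ℂ) * spin ν c (σ i) (σ j) * ((t j)⁻¹ : ℂˣ) := by
  have hU : IsUnit c.2.2.det := hc.1.2
  have hU' : IsUnit c'.2.2.det := hc'.1.2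
  constructor
  · rintro ⟨g, h, -, he⟩
    have hg := isUnit_det_coe g
    have hi : ((g⁻¹ : GL (Fin n) ℂ) : Mat n) = (g : Mat n)⁻¹ := Matrix.coe_units_inv g
    have intertwine {M M' : Mat n} (hM : M' = (g : Mat n) * M * ((g⁻¹ : GL (Fin n) ℂ) : Mat n)) :
        (g : Mat n) * M = M' * (g : Mat n) := by
      rw [hM, hi, mul_assoc, Matrix.nonsing_inv_mul _ hg, mul_one]
    have hL := intertwine (congrArg Quad.L he)
    have hΦ₁ := intertwine (congrArg Quad.Φ₁ he)
    have hΦ₃ := intertwine (congrArg Quad.Φ₃ he)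
    obtain ⟨t, σ, ht, hσ⟩ := exists_eq_monomialMatrix hg hc.1.1 hc'.1.1 hL
    rw [ht, monomialMatrix_mul_eq_iff] at hΦ₁ hΦ₃
    refine ⟨σ, t, fun i => ⟨hσ i, ?_⟩, hΦ₃⟩
    have := hΦ₁ i i
    rw [mul_right_comm, Units.mul_inv, one_mul] at this
    rwa [cmPoint_Φ₁_diag, cmPoint_Φ₁_diag] at this
  · rintro ⟨σ, t, h1, h2⟩
    obtain ⟨g, hgt⟩ := (Matrix.isUnit_iff_isUnit_det _).2 (isUnit_det_monomialMatrix t σ)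
    have hg := isUnit_det_coe g
    have hi : ((g⁻¹ : GL (Fin n) ℂ) : Mat n) = (g : Mat n)⁻¹ := Matrix.coe_units_inv g
    have intertwine {M M' : Mat n}
        (hM : ∀ i j, M' i j = t i * M (σ i) (σ j) * ((t j)⁻¹ : ℂˣ)) :
        M' = (g : Mat n) * M * ((g⁻¹ : GL (Fin n) ℂ) : Mat n) := by
      have := (monomialMatrix_mul_eq_iff t σ M M').2 hM
      rw [← hgt] at this
      rw [this, hi, mul_assoc, Matrix.mul_nonsing_inv _ hg, mul_one]
    obtain ⟨u, hu⟩ := (Matrix.isUnit_iff_isUnit_det _).2 hU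
    obtain ⟨u', hu'⟩ := (Matrix.isUnit_iff_isUnit_det _).2 hU'
    have hui : ((u⁻¹ : GL (Fin n) ℂ) : Mat n) = c.2.2⁻¹ := by rw [Matrix.coe_units_inv, hu]
    have hs : spin ν c' = (g : Mat n) * spin ν c * ((g⁻¹ : GL (Fin n) ℂ) : Mat n) := intertwine h2
    have hh : ((u⁻¹ * g⁻¹ * u' : GL (Fin n) ℂ) : Mat n) = c.2.2⁻¹ * (g : Mat n)⁻¹ * c'.2.2 := by
      rw [Units.val_mul, Units.val_mul, hui, hi, hu']
    -- `U' = g U h` forces `h = U⁻¹ g⁻¹ U'`; it commutes with `ν` because `g` conjugates one spin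
    -- matrix to the other.
    refine ⟨g, u⁻¹ * g⁻¹ * u', ?_, ?_⟩
    · rw [hh]
      have hs' : c'.2.2 * ν * c'.2.2⁻¹ = (g : Mat n) * (c.2.2 * ν * c.2.2⁻¹) * (g : Mat n)⁻¹ := by
        rw [← hi]; exact hs
      have := congrArg (fun Z => c.2.2⁻¹ * (g : Mat n)⁻¹ * Z * c'.2.2) hs'
      simpa only [mul_assoc, inv_mul_cancel_left' hg, inv_mul_cancel_left' hU,
        Matrix.nonsing_inv_mul _ hU', mul_one] using this
    · refine Prod.ext (intertwine fun i j => ?_) (Prod.ext ?_ (Prod.ext (intertwine fun i j => ?_)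
        hs))
      · change Matrix.diagonal (fun i => Complex.exp (2 * c'.1 i)) i j =
          (t i : ℂ) * Matrix.diagonal (fun i => Complex.exp (2 * c.1 i)) (σ i) (σ j) * _
        rw [Matrix.diagonal_apply, Matrix.diagonal_apply]
        rcases eq_or_ne i j with rfl | hij
        · rw [if_pos rfl, if_pos rfl, mul_right_comm, Units.mul_inv, one_mul, (h1 i).1]
        · rw [if_neg hij, if_neg (σ.injective.ne hij), mul_zero, zero_mul]
      · change c'.2.2 = (g : Mat n) * c.2.2 * ((u⁻¹ * g⁻¹ * u' : GL (Fin n) ℂ) : Mat n)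
        rw [hh]
        simp only [mul_assoc, mul_inv_cancel_left' hU, mul_inv_cancel_left' hg]
      · change (cmPoint ν c').Φ₁ i j = (t i : ℂ) * (cmPoint ν c).Φ₁ (σ i) (σ j) * _
        rcases eq_or_ne i j with rfl | hij
        · rw [cmPoint_Φ₁_diag, cmPoint_Φ₁_diag, mul_right_comm, Units.mul_inv, one_mul, (h1 i).2]
        · rw [cmPoint_Φ₁_off ν c' hij, cmPoint_Φ₁_off ν c (σ.injective.ne hij), h2,
            exp_two_ratio, exp_two_ratio, (h1 i).1, (h1 j).1]
          ring

end CalogeroMoser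

/-! ### The Hamiltonians in Calogero–Moser coordinates -/

section Hamiltonians

variable {n : ℕ}

theorem sum_sum_eq_diag_add (F : Fin n → Fin n → ℂ) :
    ∑ i, ∑ j, F i j = ∑ i, F i i + ∑ i, ∑ j ∈ Finset.univ.erase i, F i j := by
  rw [← Finset.sum_add_distrib]
  exact Finset.sum_congr rfl fun i _ => (Finset.add_sum_erase _ _ (Finset.mem_univ i)).symm

theorem sinh_sq_eq (x y : ℂ) : (Complex.exp (2 * y - 2 * x) - 1) *
    (Complex.exp (2 * x - 2 * y) - 1) = -(4 * Complex.sinh (x - y) ^ 2) := by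
  have h1 : Complex.exp (2 * y - 2 * x) = Complex.exp (-(x - y)) ^ 2 := by
    rw [← Complex.exp_nat_mul]; congr 1; push_cast; ring
  have h2 : Complex.exp (2 * x - 2 * y) = Complex.exp (x - y) ^ 2 := by
    rw [← Complex.exp_nat_mul]; congr 1; push_cast; ring
  have h3 : Complex.exp (-(x - y)) * Complex.exp (x - y) = 1 := by
    rw [← Complex.exp_add, neg_add_cancel, Complex.exp_zero]
  rw [h1, h2, Complex.sinh]
  linear_combination (Complex.exp (-(x - y)) * Complex.exp (x - y) - 1) * h3

/-- The entries `ij` and `ji` of `Φ₁` multiply to `f_{ij} f_{ji}` over the product in `sinh_sq_eq`.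
For the second trace, `Φ₂` brings in `E' = e^{2x_i - 2x_j}`, and `E E' = 1` with `E = e^{2x_j -
2x_i}` gives `E' / (E' - 1) = -1 / (E - 1)`. -/
theorem hamiltonians {y : Quad n} (hy : y ∈ zeroLevel n) {x : Fin n → ℂ}
    (hL : y.L = Matrix.diagonal fun i => Complex.exp (2 * x i)) :
    (y.Φ₁ * y.Φ₁).trace = ∑ i, y.Φ₁ i i ^ 2
        - 1 / 4 * ∑ i, ∑ j ∈ Finset.univ.erase i,
            y.Φ₃ i j * y.Φ₃ j i / Complex.sinh (x i - x j) ^ 2 ∧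
      (y.Φ₁ * y.Φ₂).trace = ∑ i, y.Φ₁ i i ^ 2
        - ∑ i, ∑ j ∈ Finset.univ.erase i,
            y.Φ₃ i j * y.Φ₃ j i / (Complex.exp (2 * x j - 2 * x i) - 1) ^ 2 := by
  have hinj : Function.Injective fun i => Complex.exp (2 * x i) := by
    rw [← diagonal_exp_mem_iff, ← hL]
    exact hy.1.1
  have hlev := (conjMoment_eq_zero_iff hinj hL).1 hy.2
  have hΦ₂ (i j : Fin n) : y.Φ₂ i j = Complex.exp (2 * x j - 2 * x i) * y.Φ₁ i j := by
    rw [Quad.Φ₂, hL, conj_diagonal_exp_apply]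
  simp only [Matrix.trace, Matrix.diag, Matrix.mul_apply]
  rw [sum_sum_eq_diag_add, sum_sum_eq_diag_add]
  constructor
  · simp only [sub_eq_add_neg (∑ i, y.Φ₁ i i ^ 2), Finset.mul_sum, ← Finset.sum_neg_distrib, ← sq]
    congr 1
    refine Finset.sum_congr rfl fun i _ => Finset.sum_congr rfl fun j hj => ?_
    have hij : i ≠ j := (Finset.ne_of_mem_erase hj).symm
    have e1 := exp_ratio_ne_one hinj hij
    have e2 := exp_ratio_ne_one hinj hij.symm
    have hs := sinh_sq_eq (x i) (x j)
    have h0 : Complex.sinh (x i - x j) ^ 2 ≠ 0 := by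
      intro h0
      rw [h0] at hs
      exact mul_ne_zero e1 e2 (by simpa using hs)
    rw [hlev.2 i j hij, hlev.2 j i hij.symm, div_mul_div_comm, hs]
    field_simp
  · simp only [sub_eq_add_neg (∑ i, y.Φ₁ i i ^ 2), ← Finset.sum_neg_distrib]
    congr 1
    · refine Finset.sum_congr rfl fun i _ => ?_
      rw [hΦ₂, sub_self, Complex.exp_zero]
      ring
    refine Finset.sum_congr rfl fun i _ => Finset.sum_congr rfl fun j hj => ?_
    have hij : i ≠ j := (Finset.ne_of_mem_erase hj).symm
    have e1 := exp_ratio_ne_one hinj hij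
    have e2 := exp_ratio_ne_one hinj hij.symm
    have he : Complex.exp (2 * x j - 2 * x i) * Complex.exp (2 * x i - 2 * x j) = 1 := by
      rw [← Complex.exp_add, sub_add_sub_cancel', sub_self, Complex.exp_zero]
    rw [hΦ₂, hlev.2 i j hij, hlev.2 j i hij.symm]
    generalize Complex.exp (2 * x j - 2 * x i) = E at *
    generalize Complex.exp (2 * x i - 2 * x j) = E' at *
    field_simp
    linear_combination (y.Φ₃ i j * y.Φ₃ j i) * he

end Hamiltonians

/-! ## The symplectic form in Calogero–Moser coordinates -/

section CMForm

attribute [local instance] Matrix.linftyOpNormedRing Matrix.linftyOpNormedAlgebra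

variable {n : ℕ}

theorem HasDifferential.of_entries {E : Type*} [NormedAddCommGroup E] [NormedSpace ℂ E]
    {f : E → Mat n} {x : E} {f' : Fin n → Fin n → (E →L[ℂ] ℂ)}
    (h : ∀ i j, HasFDerivAt (fun y => f y i j) (f' i j) x) :
    HasDifferential f x (fun v => Matrix.of fun i j => f' i j v) := by
  have hs : HasFDerivAt (fun y => ∑ i, ∑ j, f y i j • Matrix.single i j (1 : ℂ))
      (∑ i, ∑ j, (f' i j).smulRight (Matrix.single i j (1 : ℂ))) x :=
    HasFDerivAt.fun_sum fun i _ => HasFDerivAt.fun_sum fun j _ => (h i j).smul_const _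
  have hsum (A : Mat n) : ∑ i, ∑ j, A i j • Matrix.single i j (1 : ℂ) = A := by
    conv_rhs => rw [Matrix.matrix_eq_sum_single A]
    simp [Matrix.smul_single]
  simp only [hsum] at hs
  refine (HasDifferential.of_hasFDerivAt hs).congr_right fun v => ?_
  rw [← hsum (Matrix.of fun i j => f' i j v)]
  simp only [_root_.sum_apply, ContinuousLinearMap.smulRight_apply]
  rfl

theorem HasDifferential.entry {E : Type*} [NormedAddCommGroup E] [NormedSpace ℂ E]
    {f : E → Mat n} {x : E} {D : E → Mat n} (h : HasDifferential f x D) (i j : Fin n) :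
    DifferentiableAt ℂ (fun y => f y i j) x := by
  let T : Mat n →L[ℂ] ℂ := LinearMap.toContinuousLinearMap (Matrix.entryLinearMap ℂ ℂ i j)
  exact (T.hasFDerivAt.comp x h.1.hasFDerivAt).differentiableAt

variable {ν : Mat n} {c : CMCoord n}

/-- The differential of the spin matrix. -/
def dSpin (ν : Mat n) (c v : CMCoord n) : Mat n :=
  v.2.2 * c.2.2⁻¹ * spin ν c - spin ν c * (v.2.2 * c.2.2⁻¹)

theorem hasDifferential_spin (hc : IsUnit c.2.2.det) :
    HasDifferential (spin ν) c (dSpin ν c) := by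
  have hU : HasDifferential (fun c : CMCoord n => c.2.2) c (fun v => v.2.2) :=
    .of_clm ((ContinuousLinearMap.snd ℂ _ _).comp (ContinuousLinearMap.snd ℂ _ _)) fun _ => rfl
  refine ((hU.mul (.const ν)).mul (hU.inv hc)).congr_right fun v => ?_
  simp only [dSpin, spin, mul_assoc, inv_mul_cancel_left' hc, mul_zero, add_zero, mul_neg,
    sub_eq_add_neg]

theorem hasFDerivAt_position (i : Fin n) :
    HasFDerivAt (fun c : CMCoord n => c.1 i)
      ((ContinuousLinearMap.proj i).comp (ContinuousLinearMap.fst ℂ (Fin n → ℂ) _)) c :=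
  ((ContinuousLinearMap.proj i).comp (ContinuousLinearMap.fst ℂ (Fin n → ℂ)
    ((Fin n → ℂ) × Mat n))).hasFDerivAt

theorem hasFDerivAt_momentum (i : Fin n) :
    HasFDerivAt (fun c : CMCoord n => c.2.1 i)
      ((ContinuousLinearMap.proj i).comp ((ContinuousLinearMap.fst ℂ (Fin n → ℂ) _).comp
        (ContinuousLinearMap.snd ℂ (Fin n → ℂ) _))) c :=
  ((ContinuousLinearMap.proj i).comp ((ContinuousLinearMap.fst ℂ (Fin n → ℂ) (Mat n)).comp
    (ContinuousLinearMap.snd ℂ (Fin n → ℂ) ((Fin n → ℂ) × Mat n)))).hasFDerivAt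

theorem hasDifferential_diagonal_exp :
    HasDifferential (fun c : CMCoord n => Matrix.diagonal fun i => Complex.exp (2 * c.1 i)) c
      (fun v => Matrix.diagonal fun i => Complex.exp (2 * c.1 i) * (2 * v.1 i)) := by
  have h (i j : Fin n) : HasFDerivAt
      (fun c : CMCoord n => (Matrix.diagonal fun i => Complex.exp (2 * c.1 i)) i j)
      (if i = j then Complex.exp (2 * c.1 i) • (2 : ℂ) • ((ContinuousLinearMap.proj i).comp
        (ContinuousLinearMap.fst ℂ (Fin n → ℂ) ((Fin n → ℂ) × Mat n))) else 0) c := by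
    rcases eq_or_ne i j with rfl | hij
    · simp only [Matrix.diagonal_apply_eq, if_true]
      exact ((hasFDerivAt_position i).const_mul 2).cexp
    · simp only [Matrix.diagonal_apply_ne _ hij, if_neg hij]
      exact hasFDerivAt_const _ _
  refine (HasDifferential.of_entries h).congr_right fun v => ?_
  ext i j
  rw [Matrix.of_apply, Matrix.diagonal_apply]
  split_ifs <;> rfl

/-- Off the diagonal only differentiability matters: `δΛ` is diagonal, so those entries of the
differential never enter the form. -/
theorem exists_hasDifferential_Φ₁ (hc : c ∈ cmDomain n) :
    ∃ M : CMCoord n → Mat n, (∀ v i, M v i i = v.2.1 i) ∧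
      HasDifferential (fun c => (cmPoint ν c).Φ₁) c M := by
  have h (i j : Fin n) : ∃ f' : CMCoord n →L[ℂ] ℂ,
      HasFDerivAt (fun c : CMCoord n => (cmPoint ν c).Φ₁ i j) f' c ∧
        (i = j → ∀ v, f' v = v.2.1 i) := by
    rcases eq_or_ne i j with rfl | hij
    · simp only [cmPoint_Φ₁_diag]
      exact ⟨_, hasFDerivAt_momentum i, fun _ _ => rfl⟩
    · simp only [cmPoint_Φ₁_off ν _ hij]
      refine ⟨_, DifferentiableAt.hasFDerivAt ?_, fun h => absurd h hij⟩
      have h1 := (hasDifferential_spin (ν := ν) hc.2).entry i j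
      have h2 : DifferentiableAt ℂ
          (fun c : CMCoord n => Complex.exp (2 * c.1 j - 2 * c.1 i) - 1) c :=
        ((((hasFDerivAt_position j).const_mul 2).sub
          ((hasFDerivAt_position i).const_mul 2)).cexp.sub_const 1).differentiableAt
      simp only [div_eq_mul_inv]
      exact h1.mul (h2.fun_inv (exp_ratio_ne_one hc.1 hij))
  choose f' hf hd using h
  exact ⟨_, fun v i => hd i i rfl v, HasDifferential.of_entries hf⟩

theorem fderiv_cmPoint_aux (hc : c ∈ cmDomain n) :
    DifferentiableAt ℂ (cmPoint ν) c ∧ ∃ M : CMCoord n → Mat n, (∀ v i, M v i i = v.2.1 i) ∧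
      ∀ v, fderiv ℂ (cmPoint ν) c v =
        (Matrix.diagonal fun i => Complex.exp (2 * c.1 i) * (2 * v.1 i), v.2.2, M v,
          dSpin ν c v) := by
  obtain ⟨M, hM, hΦ⟩ := exists_hasDifferential_Φ₁ (ν := ν) hc
  have hU : HasDifferential (fun c : CMCoord n => c.2.2) c (fun v => v.2.2) :=
    .of_clm ((ContinuousLinearMap.snd ℂ _ _).comp (ContinuousLinearMap.snd ℂ _ _)) fun _ => rfl
  have hL := hasDifferential_diagonal_exp (c := c)
  have hS := hasDifferential_spin (ν := ν) hc.2
  have h := hL.1.hasFDerivAt.prodMk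
    (hU.1.hasFDerivAt.prodMk (hΦ.1.hasFDerivAt.prodMk hS.1.hasFDerivAt))
  refine ⟨h.differentiableAt, M, hM, fun v => ?_⟩
  refine .trans ?_ (congrArg₂ Prod.mk (hL.2 v) (congrArg₂ Prod.mk (hU.2 v)
    (congrArg₂ Prod.mk (hΦ.2 v) (hS.2 v))))
  exact congrArg (fun T : CMCoord n →L[ℂ] Quad n => T v) h.fderiv

end CMForm

/-! ### Evaluation of the two-form in the coordinates -/

section CMForm

variable {n : ℕ} {ν : Mat n} {c : CMCoord n}

theorem fderiv_cmPoint (hc : c ∈ cmDomain n) :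
    DifferentiableAt ℂ (cmPoint ν) c ∧ ∃ M : CMCoord n → Mat n, (∀ v i, M v i i = v.2.1 i) ∧
      ∀ v, fderiv ℂ (cmPoint ν) c v =
        (Matrix.diagonal fun i => Complex.exp (2 * c.1 i) * (2 * v.1 i), v.2.2, M v,
          dSpin ν c v) :=
  fderiv_cmPoint_aux hc

theorem cmPoint_mem_phaseSpace (hc : c ∈ cmDomain n) : cmPoint ν c ∈ phaseSpace n :=
  ⟨((diagonal_exp_mem_iff _).2 hc.1).1, hc.2⟩

/-- The `Λ` term gives `2 δp_i δ'x_i - 4 p_i δx_i δ'x_i` summed over `i`, whose second part is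
symmetric and cancels. With `a = δU U⁻¹`, `b = δ'U U⁻¹`, `δ(U⁻¹ f) = -U⁻¹ f a`, so the `U` term
antisymmetrises to `-Tr (f [a, b])`. -/
theorem nodeForm_cmPoint (hc : c ∈ cmDomain n) (v w : CMCoord n) :
    nodeForm (cmPoint ν c) (fderiv ℂ (cmPoint ν) c v) (fderiv ℂ (cmPoint ν) c w) =
      cmForm ν c v w := by
  obtain ⟨-, M, hM, hD⟩ := fderiv_cmPoint (ν := ν) hc
  rw [nodeForm_eq (cmPoint_mem_phaseSpace hc)]
  have hA (v w : CMCoord n) : (dA (cmPoint ν c) (fderiv ℂ (cmPoint ν) c v) *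
      (fderiv ℂ (cmPoint ν) c w).L).trace =
      2 * ∑ i, (v.2.1 i * w.1 i - 2 * v.1 i * c.2.1 i * w.1 i) := by
    rw [hD, hD, Matrix.trace, Finset.mul_sum]
    refine Finset.sum_congr rfl fun i _ => ?_
    have he := Complex.exp_ne_zero (2 * c.1 i)
    change (((Matrix.diagonal fun i => Complex.exp (2 * c.1 i))⁻¹ * M v -
      (Matrix.diagonal fun i => Complex.exp (2 * c.1 i))⁻¹ *
        (Matrix.diagonal fun i => Complex.exp (2 * c.1 i) * (2 * v.1 i)) *
        ((Matrix.diagonal fun i => Complex.exp (2 * c.1 i))⁻¹ * (cmPoint ν c).Φ₁)) *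
      (Matrix.diagonal fun i => Complex.exp (2 * c.1 i) * (2 * w.1 i)) : Mat n) i i = _
    rw [diagonal_exp_inv, Matrix.mul_diagonal, Matrix.sub_apply, Matrix.diagonal_mul,
      Matrix.diagonal_mul_diagonal, Matrix.diagonal_mul, Matrix.diagonal_mul, hM, cmPoint_Φ₁_diag]
    field_simp
  have hC (v w : CMCoord n) : (dC (cmPoint ν c) (fderiv ℂ (cmPoint ν) c v) *
      (fderiv ℂ (cmPoint ν) c w).U).trace =
      -(spin ν c * (v.2.2 * c.2.2⁻¹ * (w.2.2 * c.2.2⁻¹))).trace := by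
    rw [hD, hD]
    change ((c.2.2⁻¹ * dSpin ν c v - c.2.2⁻¹ * v.2.2 * (c.2.2⁻¹ * spin ν c)) * w.2.2).trace = _
    have e := Matrix.trace_mul_comm (c.2.2⁻¹ * (spin ν c * (v.2.2 * c.2.2⁻¹))) w.2.2
    have e' := Matrix.trace_mul_comm (spin ν c * (v.2.2 * c.2.2⁻¹)) (w.2.2 * c.2.2⁻¹)
    simp only [dSpin, mul_sub, sub_mul, trace_sub, mul_assoc] at *
    linear_combination -e + e'
  rw [hA, hA, hC, hC, cmForm]
  simp only [mul_sub, trace_sub, Finset.sum_sub_distrib]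
  have : ∑ i, 2 * v.1 i * c.2.1 i * w.1 i = ∑ i, 2 * w.1 i * c.2.1 i * v.1 i :=
    Finset.sum_congr rfl fun i _ => by ring
  rw [this]
  ring

end CMForm

end NodeHitchin

end

theorem mainTheorem9 (n : ℕ) (N : MarkedNode) :
    -- the moduli space of framed bundles, presented as an open set of matrices
    ((∀ m ∈ bundleData n, ∀ m' ∈ bundleData n, moduliMap m = moduliMap m' ↔ FramedIso N m m') ∧
      moduliMap '' bundleData n = principalCell n ∧
      IsOpen (principalCell n) ∧
      ∀ m ∈ bundleData n, DifferentiableAt ℂ moduliMap m ∧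
        Function.Surjective (fderiv ℂ (moduliMap (n := n)) m)) ∧
    -- the global sections of `End(V)* ⊗ 𝒦 ⊗ 𝒪(p)`
    (∀ Λ ∈ principalCell n, ∀ Φ : RatMat n, Φ ∈ higgsFields N Λ ↔
      ∃ Φ₁ Φ₂ Φ₃ : Mat n, Φ₁ * Λ = Λ * Φ₂ ∧ Φ₁ - Φ₂ + Φ₃ = 0 ∧ Φ = higgsField N Φ₁ Φ₂ Φ₃) ∧
    -- the conjugation action is Hamiltonian, with moment map `Φ₁ - Φ₂ + Φ₃`
    ((∀ y ∈ phaseSpace n, ∀ v w : Quad n, ∀ g : GL (Fin n) ℂ,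
        nodeForm (conjAct g y) (conjAct g v) (conjAct g w) = nodeForm y v w) ∧
      ∀ y ∈ phaseSpace n, ∀ a : Mat n,
        oneForm y (conjField a y) = (conjMoment y * a).trace ∧
        ∀ v : Quad n, nodeForm y (conjField a y) v = -(fderiv ℂ conjMoment y v * a).trace) ∧
    -- the reduction at level zero is the cotangent bundle of the moduli space
    (∃ P : Quad n → Cotangent n,
      DifferentiableOn ℂ P (phaseSpace n) ∧
      P '' zeroLevel n = {q | q.1 ∈ principalCell n} ∧
      (∀ y ∈ zeroLevel n, ∀ y' ∈ zeroLevel n,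
        P y = P y' ↔ ∃ g : GL (Fin n) ℂ, y' = conjAct g y) ∧
      ∀ y ∈ zeroLevel n,
        -- `P y` is the point `(V, Φ)`: the tangent space of the moduli space at `V` is `H¹`,
        -- and `Φ` acts on it by Serre's pairing
        (P y).1 = moduliMap (y.L, y.U) ∧
        (∃ κ : H1 N y.L ≃ₗ[ℂ] Mat n,
          (∀ χ : PolyMat n, κ (Submodule.Quotient.mk (polyCochain N χ)) =
            fderiv ℂ moduliMap (y.L, y.U) (deformation N (y.L, y.U) χ)) ∧
          ∀ c : cochains N n, ((P y).2 * κ (Submodule.Quotient.mk c)).trace =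
            serrePairing N (higgsField N y.Φ₁ y.Φ₂ y.Φ₃) c) ∧
        -- `P` is a submersion on the level set, and the canonical forms pull back as claimed
        (∀ q : Cotangent n, ∃ v : Quad n,
          fderiv ℂ conjMoment y v = 0 ∧ fderiv ℂ P y v = q) ∧
        ∀ v : Quad n, fderiv ℂ conjMoment y v = 0 →
          canonicalOneForm (P y) (fderiv ℂ P y v) = oneForm y v ∧
          ∀ w : Quad n, fderiv ℂ conjMoment y w = 0 →
            canonicalForm (P y) (fderiv ℂ P y v) (fderiv ℂ P y w) = nodeForm y v w) ∧
    -- the action on the framing is Hamiltonian, with moment map `U⁻¹ Φ₃ U`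
    ((∀ y ∈ phaseSpace n, ∀ v w : Quad n, ∀ h : GL (Fin n) ℂ,
        nodeForm (frameAct h y) (frameAct h v) (frameAct h w) = nodeForm y v w) ∧
      ∀ y ∈ phaseSpace n, ∀ a : Mat n,
        oneForm y (frameField a y) = (frameMoment y * a).trace ∧
        ∀ v : Quad n, nodeForm y (frameField a y) v = -(fderiv ℂ frameMoment y v * a).trace) ∧
    -- reduction at the value `ν` of the second moment map, in the coordinates `x`, `p`, `f`
    (∀ ν : Mat n,
      (∀ c ∈ cmLevel ν, cmPoint ν c ∈ zeroLevel n ∧ frameMoment (cmPoint ν c) = ν) ∧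
      (∀ y ∈ zeroLevel n, frameMoment y = ν →
        ∃ g : GL (Fin n) ℂ, ∃ c ∈ cmLevel ν, conjAct g y = cmPoint ν c) ∧
      (∀ c ∈ cmLevel ν, ∀ c' ∈ cmLevel ν,
        (∃ g h : GL (Fin n) ℂ, (h : Mat n) * ν = ν * (h : Mat n) ∧
            cmPoint ν c' = frameAct h (conjAct g (cmPoint ν c))) ↔
          ∃ σ : Equiv.Perm (Fin n), ∃ t : Fin n → ℂˣ,
            (∀ i, Complex.exp (2 * c'.1 i) = Complex.exp (2 * c.1 (σ i)) ∧
              c'.2.1 i = c.2.1 (σ i)) ∧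
            ∀ i j, spin ν c' i j = (t i : ℂ) * spin ν c (σ i) (σ j) * ((t j)⁻¹ : ℂˣ)) ∧
      ∀ c ∈ cmDomain n, DifferentiableAt ℂ (cmPoint ν) c ∧ ∀ v w : CMCoord n,
        nodeForm (cmPoint ν c) (fderiv ℂ (cmPoint ν) c v) (fderiv ℂ (cmPoint ν) c w)
          = cmForm ν c v w) ∧
    -- the Hamiltonians
    (∀ y ∈ zeroLevel n, ∀ x : Fin n → ℂ,
      y.L = Matrix.diagonal (fun i => Complex.exp (2 * x i)) →
      (y.Φ₁ * y.Φ₁).trace = ∑ i, y.Φ₁ i i ^ 2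
        - 1 / 4 * ∑ i, ∑ j ∈ Finset.univ.erase i,
            y.Φ₃ i j * y.Φ₃ j i / Complex.sinh (x i - x j) ^ 2 ∧
      (y.Φ₁ * y.Φ₂).trace = ∑ i, y.Φ₁ i i ^ 2
        - ∑ i, ∑ j ∈ Finset.univ.erase i,
            y.Φ₃ i j * y.Φ₃ j i / (Complex.exp (2 * x j - 2 * x i) - 1) ^ 2) := by
  refine ⟨⟨fun m hm m' hm' => framedIso_iff N hm.2 hm'.2, image_moduliMap, isOpen_principalCell,
      fun m hm => ⟨(fderiv_moduliMap hm.2).1, surjective_fderiv_moduliMap hm.2⟩⟩,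
    fun Λ _ Φ => mem_higgsFields_iff Λ Φ,
    ⟨fun y hy v w g => nodeForm_conjAct hy g v w,
      fun y hy a => ⟨oneForm_conjField hy a, nodeForm_conjField hy a⟩⟩,
    ⟨reductionMap, fun y hy => (fderiv_reductionMap hy).1.differentiableWithinAt,
      image_reductionMap, fun y hy y' hy' => reductionMap_eq_iff hy hy', fun y hy => ?_⟩,
    ⟨fun y hy v w h => nodeForm_frameAct hy h v w,
      fun y hy a => ⟨oneForm_frameField y a, nodeForm_frameField hy a⟩⟩,
    fun ν => ⟨fun c hc => ⟨cmPoint_mem_zeroLevel hc, frameMoment_cmPoint hc.1.2⟩,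
      fun y hy h => exists_conjAct_eq_cmPoint hy h,
      fun c hc c' hc' => cmPoint_equivalent_iff hc hc',
      fun c hc => ⟨(fderiv_cmPoint hc).1, nodeForm_cmPoint hc⟩⟩,
    fun y hy x hL => hamiltonians hy hL⟩
  have hp := mem_phaseSpace_of_mem_zeroLevel hy
  refine ⟨rfl, ⟨kodairaSpencerEquiv N (m := (y.L, y.U)) hp.1 hp.2, fun χ => ?_, fun c => ?_⟩,
    reductionMap_submersion hp, fun v hv => ⟨canonicalOneForm_reductionMap hy v,
      fun w hw => canonicalForm_reductionMap hy hv hw⟩⟩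
  · exact kodairaSpencer_toRat_eq_fderiv N hp.2 χ
  · exact trace_mul_kodairaSpencer N hy c
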